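/- Let $\mathfrak A$ be a unital $C^*$-algebra. Put - $\mathfrak A^\dagger=\{a\in\mathfrak A\mid a\in a\mathfrak A a\}$ (regular elements); every $a\in\mathfrak A^\dagger$ has a unique Moore–Penrose inverse $a^\dagger\in\mathfrak A$, i.e. $aa^\dagger a=a$, $a^\dagger aa^\dagger=a^\dagger$, $(a^\dagger a)^*=a^\dagger a$, $(aa^\dagger)^*=aa^\dagger$; - $\mathcal Q(\mathfrak A)=\{a\mid a^2=a\}$ and $\mathcal G(\mathfrak A)=\{(a,b)\in\mathfrak A\times\mathfrak A\mid aba=a,\ bab=b\}$, which is a groupoid over $\mathcal Q(\mathfrak A)$ with source $\mathbf s(a,b)=ba$, target $\mathbf t(a,b)=ab$, product $(a_1,b_1)(a_2,b_2)=(a_1a_2,b_2b_1)$ if $\mathbf s(a_1,b_1)=\mathbf t(a_2,b_2)$, units $p\mapsto(p,p)$ and inversion $(a,b)\mapsto(b,a)$; - $\mathcal P(\mathfrak A)=\{p\mid p=p^2=p^*\}$ and $\mathcal U(\mathfrak A)=\{a\mid aa^*,a^*a\in\mathcal P(\mathfrak A)\}$ (partial isometries), which is a groupoid over $\mathcal P(\mathfrak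 A)$ with source $a^*a$, target $aa^*$, product $ab$ if $a^*a=bb^*$, units $p\mapsto p$ and inversion $a\mapsto a^*$. The sets $\mathcal Q(\mathfrak A),\mathcal P(\mathfrak A),\mathcal U(\mathfrak A)\subseteq\mathfrak A$ and $\mathcal G(\mathfrak A)\subseteq\mathfrak A\times\mathfrak A$ are regarded as (closed, split, embedded, smooth real) Banach submanifolds. A Banach–Lie groupoid is a topological groupoid whose total space and base are Hausdorff smooth Banach manifolds (the model space may vary between components), whose source map is a submersion (surjective, with surjective tangent maps having split kernels), and whose inversion and multiplication are smooth; a morphism of Banach–Lie groupoids is a continuous morphism of groupoids that is smooth on the total space. Then: (i) The maps $\eta\colon\mathfrak A^\dagger\to\mathcal G(\mathfrak A)$, $\eta(a)=(a,a^\dagger)$, and $\pi\colon\mathcal G(\mathfrak A)\to\mathfrak A^\dagger$, $\pi(a,b)=a$, are well defined and $\pi\circ\eta=\mathrm{id}_{\mathfrak A^\dagger}$. (ii) For any sequence $(a_n)_{n\ge1}$ in $\mathfrak A^\dagger\setminus\{0\}$ and any $a\in\mathfrak A^\dagger\setminus\{0\}$ with $\lim_{n\to\infty}a_n=a$, one has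 $\lim_{n\to\infty}\eta(a_n)=\eta(a)$ if and only if $\lim_{n\to\infty}\mathbf s(\eta(a_n))=\mathbf s(\eta(a))$, that is, $\lim_{n\to\infty}a_n^\dagger a_n=a^\dagger a$. (iii) One has $\mathcal U(\mathfrak A)\subseteq\mathfrak A^\dagger$, and, with the above submanifold structures (which exist), $\mathcal U(\mathfrak A)\rightrightarrows\mathcal P(\mathfrak A)$ and $\mathcal G(\mathfrak A)\rightrightarrows\mathcal Q(\mathfrak A)$ are Banach–Lie groupoids and $\eta|_{\mathcal U(\mathfrak A)}\colon\mathcal U(\mathfrak A)\to\mathcal G(\mathfrak A)$ is an injective morphism of Banach–Lie groupoids, over the inclusion $\mathcal P(\mathfrak A)\hookrightarrow\mathcal Q(\mathfrak A)$. -/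

import Mathlib

open Filter Topology
open scoped ContDiff

universe u v

/-! ### Not necessarily Hausdorff Banach manifolds

The model Banach space is allowed to change from chart to chart (hence from one connected
component to another), so the charted spaces over one fixed model are not general enough. -/

/-- A smooth atlas on the topological space `M`: charts onto open subsets of real Banach spaces,
covering `M`, with smooth transition maps; `idx x` picks a chart around the point `x`.
The space `M` is not required to be Hausdorff. -/
structure BanachManifold (M : Type u) [TopologicalSpace M] where
  ι : Type u
  model : ι → Type u
  [normedAddCommGroup : ∀ i, NormedAddCommGroup (model i)]
  [normedSpace : ∀ i, NormedSpace ℝ (model i)]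
  [completeSpace : ∀ i, CompleteSpace (model i)]
  chart : ∀ i, OpenPartialHomeomorph M (model i)
  idx : M → ι
  mem_source : ∀ x, x ∈ (chart (idx x)).source
  contDiffOn_transition : ∀ i j, ContDiffOn ℝ ∞ (fun e => chart j ((chart i).symm e))
    ((chart i).symm.trans (chart j)).source

namespace BanachManifold

attribute [instance] normedAddCommGroup normedSpace completeSpace

/-- A Banach space, as a manifold with one chart. -/
noncomputable def ofBanachSpace (E : Type u) [NormedAddCommGroup E] [NormedSpace ℝ E] [CompleteSpace E] :
    BanachManifold E where
  ι := PUnit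
  model := fun _ => E
  chart := fun _ => OpenPartialHomeomorph.refl E
  idx := fun _ => PUnit.unit
  mem_source := fun _ => trivial
  contDiffOn_transition := fun _ _ => contDiff_id.contDiffOn

section

variable {M : Type u} [TopologicalSpace M] {N : Type u} [TopologicalSpace N]

/-- The product of two Banach manifolds. -/
noncomputable def prod (X : BanachManifold M) (Y : BanachManifold N) : BanachManifold (M × N) where
  ι := X.ι × Y.ι
  model := fun i => X.model i.1 × Y.model i.2
  chart := fun i => (X.chart i.1).prod (Y.chart i.2)
  idx := fun x => (X.idx x.1, Y.idx x.2)
  mem_source := fun x => ⟨X.mem_source x.1, Y.mem_source x.2⟩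
  contDiffOn_transition := fun i j => by
    have h1 := (X.contDiffOn_transition i.1 j.1).comp
      (s := (((X.chart i.1).prod (Y.chart i.2)).symm.trans
        ((X.chart j.1).prod (Y.chart j.2))).source)
      (contDiff_fst (E := X.model i.1) (F := Y.model i.2)).contDiffOn
      (fun e he => ⟨he.1.1, he.2.1⟩)
    have h2 := (Y.contDiffOn_transition i.2 j.2).comp
      (s := (((X.chart i.1).prod (Y.chart i.2)).symm.trans
        ((X.chart j.1).prod (Y.chart j.2))).source)
      (contDiff_snd (E := X.model i.1) (F := Y.model i.2)).contDiffOn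
      (fun e he => ⟨he.1.2, he.2.2⟩)
    exact h1.prodMk h2

/-- The tangent space at a point, read in the chosen chart around that point. -/
abbrev TangentSpaceAt (X : BanachManifold M) (x : M) : Type u := X.model (X.idx x)

/-- The expression of `f` in the chosen charts around `x` and `f x`. -/
def inCharts (X : BanachManifold M) (Y : BanachManifold N) (f : M → N) (x : M) :
    X.TangentSpaceAt x → Y.TangentSpaceAt (f x) :=
  fun e => Y.chart (Y.idx (f x)) (f ((X.chart (X.idx x)).symm e))

/-- Smoothness of a map at a point. -/
def SmoothAt (X : BanachManifold M) (Y : BanachManifold N) (f : M → N) (x : M) : Prop :=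
  ContinuousAt f x ∧ ContDiffAt ℝ ∞ (inCharts X Y f x) (X.chart (X.idx x) x)

/-- Smooth maps between Banach manifolds. -/
def Smooth (X : BanachManifold M) (Y : BanachManifold N) (f : M → N) : Prop :=
  ∀ x, SmoothAt X Y f x

/-- Smoothness of a map defined on a (sub)set `S` of a manifold: locally, it is the restriction
of a smooth map defined on an open subset of the manifold. On a submanifold this is smoothness
with respect to its induced manifold structure. -/
def SmoothOnSubset (X : BanachManifold M) (Y : BanachManifold N) {S : Set M} (f : S → N) : Prop :=
  ∀ x : S, ∃ F : M → N, (∀ᶠ y in 𝓝 (x : M), SmoothAt X Y F y) ∧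
    ∀ᶠ y in 𝓝 (x : M), ∀ hy : y ∈ S, F y = f ⟨y, hy⟩

/-- The tangent map of `f` at `x`. -/
noncomputable def tangentMapAt (X : BanachManifold M) (Y : BanachManifold N) (f : M → N) (x : M) :
    X.TangentSpaceAt x →L[ℝ] Y.TangentSpaceAt (f x) :=
  fderiv ℝ (inCharts X Y f x) (X.chart (X.idx x) x)

/-- Submersions: surjective smooth maps whose tangent maps are surjective with split kernel. -/
structure IsSubmersion (X : BanachManifold M) (Y : BanachManifold N) (f : M → N) : Prop where
  surjective : Function.Surjective f
  smooth : Smooth X Y f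
  tangent_surjective : ∀ x, Function.Surjective (tangentMapAt X Y f x)
  ker_split : ∀ x, (tangentMapAt X Y f x : X.TangentSpaceAt x →ₗ[ℝ]
    Y.TangentSpaceAt (f x)).ker.ClosedComplemented

/-- Split immersions: smooth maps whose tangent maps are injective with split range. -/
structure IsSplitImmersion (X : BanachManifold M) (Y : BanachManifold N) (f : M → N) : Prop where
  smooth : Smooth X Y f
  tangent_injective : ∀ x, Function.Injective (tangentMapAt X Y f x)
  range_split : ∀ x, (tangentMapAt X Y f x : X.TangentSpaceAt x →ₗ[ℝ]
    Y.TangentSpaceAt (f x)).range.ClosedComplemented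

end

/-- The manifold structure `X` makes the subset `S` of the Banach space `E` into a (closed, split)
submanifold of `E`. The topology of `S` is the subspace topology, so the inclusion map is an
embedding, and there is at most one such structure up to equivalence of atlases. -/
structure IsSubmanifold {E : Type u} [NormedAddCommGroup E] [NormedSpace ℝ E] [CompleteSpace E]
    {S : Set E} (X : BanachManifold S) : Prop where
  isClosed : IsClosed S
  isSplitImmersion : IsSplitImmersion X (ofBanachSpace E) (Subtype.val : S → E)

end BanachManifold

/-! ### Groupoids -/

/-- An (algebraic) groupoid with set of arrows `G` and set of objects `M`; the product of `g` and
`h` is defined when the source of `g` is the target of `h`. -/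
structure GroupoidOver (G : Type u) (M : Type v) where
  src : G → M
  tgt : G → M
  mul : ∀ g h : G, src g = tgt h → G
  one : M → G
  inv : G → G
  src_mul : ∀ g h (w : src g = tgt h), src (mul g h w) = src h
  tgt_mul : ∀ g h (w : src g = tgt h), tgt (mul g h w) = tgt g
  mul_assoc : ∀ g h k (w : src g = tgt h) (z : src h = tgt k),
    mul (mul g h w) k ((src_mul g h w).trans z) = mul g (mul h k z) (w.trans (tgt_mul h k z).symm)
  src_one : ∀ x, src (one x) = x
  tgt_one : ∀ x, tgt (one x) = x
  mul_one : ∀ g, mul g (one (src g)) (tgt_one (src g)).symm = g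
  one_mul : ∀ g, mul (one (tgt g)) g (src_one (tgt g)) = g
  src_inv : ∀ g, src (inv g) = tgt g
  tgt_inv : ∀ g, tgt (inv g) = src g
  mul_inv : ∀ g, mul g (inv g) (tgt_inv g).symm = one (tgt g)
  inv_mul : ∀ g, mul (inv g) g (src_inv g) = one (src g)

namespace GroupoidOver

section

variable {G : Type u} {M : Type v} {H : Type u} {N : Type v}

/-- The set of composable pairs. -/
def composable (S : GroupoidOver G M) : Set (G × G) := {p | S.src p.1 = S.tgt p.2}

/-- The multiplication as a map on the set of composable pairs. -/
def mulMap (S : GroupoidOver G M) : S.composable → G := fun p => S.mul p.1.1 p.1.2 p.2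

/-- Algebraic morphisms of groupoids. -/
structure IsHom (S : GroupoidOver G M) (T : GroupoidOver H N) (Φ : G → H) (φ : M → N) : Prop where
  map_src : ∀ g, T.src (Φ g) = φ (S.src g)
  map_tgt : ∀ g, T.tgt (Φ g) = φ (S.tgt g)
  map_inv : ∀ g, Φ (S.inv g) = T.inv (Φ g)
  map_mul : ∀ g h (w : S.src g = S.tgt h),
    Φ (S.mul g h w) =
      T.mul (Φ g) (Φ h) (((map_src g).trans (congrArg φ w)).trans (map_tgt h).symm)
  map_one : ∀ x, Φ (S.one x) = T.one (φ x)

/-- Topological groupoids: the base is Hausdorff, the total space need not be. -/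
structure IsTopological [TopologicalSpace G] [TopologicalSpace M] (S : GroupoidOver G M) :
    Prop where
  t2_base : T2Space M
  src_surjective : Function.Surjective S.src
  src_open : IsOpenMap S.src
  src_continuous : Continuous S.src
  tgt_surjective : Function.Surjective S.tgt
  tgt_open : IsOpenMap S.tgt
  tgt_continuous : Continuous S.tgt
  mul_continuous : Continuous S.mulMap
  one_embedding : IsEmbedding S.one
  inv_homeomorph : IsHomeomorph S.inv

end

section

variable {G M H N : Type u} [TopologicalSpace G] [TopologicalSpace M] [TopologicalSpace H]
  [TopologicalSpace N]

/-- Not necessarily Hausdorff Banach-Lie groupoids, with respect to the manifold structures `X` on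
the total space and `B` on the base. -/
structure IsNNHBanachLie (S : GroupoidOver G M) (X : BanachManifold G) (B : BanachManifold M) :
    Prop where
  isTopological : S.IsTopological
  src_submersion : X.IsSubmersion B S.src
  inv_smooth : X.Smooth X S.inv
  mul_smooth : (X.prod X).SmoothOnSubset X S.mulMap

/-- Banach-Lie groupoids: the total space is Hausdorff, too. -/
structure IsBanachLie (S : GroupoidOver G M) (X : BanachManifold G) (B : BanachManifold M) :
    Prop extends S.IsNNHBanachLie X B where
  t2_total : T2Space G

/-- Morphisms of Banach-Lie groupoids: `S` and `T` are Banach-Lie groupoids, and the pair of maps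
`Φ`, `φ` is a continuous morphism of groupoids for which `Φ` is smooth. -/
structure IsBanachLieHom (S : GroupoidOver G M) (X : BanachManifold G) (B : BanachManifold M)
    (T : GroupoidOver H N) (Y : BanachManifold H) (C : BanachManifold N)
    (Φ : G → H) (φ : M → N) : Prop where
  source_isBanachLie : S.IsBanachLie X B
  target_isBanachLie : T.IsBanachLie Y C
  isHom : S.IsHom T Φ φ
  continuous_total : Continuous Φ
  continuous_base : Continuous φ
  smooth_total : X.Smooth Y Φ

end

end GroupoidOver

/-! ### Generalized inverses -/

/-- The set `Q(A)` of idempotents. -/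
def idempotents (A : Type u) [Mul A] : Set A := {a | a * a = a}

/-- The set `𝒢(A)` of pairs of elements that are generalized inverses of each other. -/
def inversePairs (A : Type u) [Mul A] : Set (A × A) :=
  {x | x.1 * x.2 * x.1 = x.1 ∧ x.2 * x.1 * x.2 = x.2}

/-- The groupoid `𝒢(A) ⇉ Q(A)` with `s(a, b) = ba`, `t(a, b) = ab`. -/
def inversePairsGroupoid (A : Type u) [Semigroup A] :
    GroupoidOver (inversePairs A) (idempotents A) where
  src := fun x => ⟨x.1.2 * x.1.1, by
    have h := x.2.2
    change _ * _ * (_ * _) = _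
    rw [← mul_assoc, h]⟩
  tgt := fun x => ⟨x.1.1 * x.1.2, by
    have h := x.2.1
    change _ * _ * (_ * _) = _
    rw [← mul_assoc, h]⟩
  mul := fun x y w => ⟨(x.1.1 * y.1.1, y.1.2 * x.1.2), by
    obtain ⟨⟨a, b⟩, h1, h2⟩ := x
    obtain ⟨⟨c, d⟩, h3, h4⟩ := y
    have w' : b * a = c * d := congrArg Subtype.val w
    dsimp only at h1 h2 h3 h4
    constructor
    · calc a * c * (d * b) * (a * c) = a * (c * d) * (b * a) * c := by simp only [mul_assoc]
        _ = a * (c * d * c * d * c) := by rw [w']; simp only [mul_assoc]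
        _ = a * c := by rw [h3, h3]
    · calc d * b * (a * c) * (d * b) = d * (b * a) * (c * d) * b := by simp only [mul_assoc]
        _ = d * (b * a * b * a * b) := by rw [← w']; simp only [mul_assoc]
        _ = d * b := by rw [h2, h2]⟩
  one := fun p => ⟨(p.1, p.1), by
    have h : p.1 * p.1 = p.1 := p.2
    constructor <;> simp only [h]⟩
  inv := fun x => ⟨(x.1.2, x.1.1), x.2.2, x.2.1⟩
  src_mul := fun x y w => by
    obtain ⟨⟨a, b⟩, h1, h2⟩ := x
    obtain ⟨⟨c, d⟩, h3, h4⟩ := y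
    have w' : b * a = c * d := congrArg Subtype.val w
    dsimp only at h1 h2 h3 h4
    refine Subtype.ext ?_
    change d * b * (a * c) = d * c
    calc d * b * (a * c) = d * (b * a) * c := by simp only [mul_assoc]
      _ = d * (c * d * c) := by rw [w']; simp only [mul_assoc]
      _ = d * c := by rw [h3]
  tgt_mul := fun x y w => by
    obtain ⟨⟨a, b⟩, h1, h2⟩ := x
    obtain ⟨⟨c, d⟩, h3, h4⟩ := y
    have w' : b * a = c * d := congrArg Subtype.val w
    dsimp only at h1 h2 h3 h4
    refine Subtype.ext ?_
    change a * c * (d * b) = a * b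
    calc a * c * (d * b) = a * (c * d) * b := by simp only [mul_assoc]
      _ = a * b * a * b := by rw [← w']; simp only [mul_assoc]
      _ = a * b := by rw [h1]
  mul_assoc := fun x y z _ _ => by
    refine Subtype.ext (Prod.ext ?_ ?_)
    · exact mul_assoc _ _ _
    · exact (mul_assoc _ _ _).symm
  src_one := fun p => Subtype.ext p.2
  tgt_one := fun p => Subtype.ext p.2
  mul_one := fun x => by
    refine Subtype.ext (Prod.ext ?_ ?_)
    · exact (mul_assoc _ _ _).symm.trans x.2.1
    · exact x.2.2
  one_mul := fun x => by
    refine Subtype.ext (Prod.ext ?_ ?_)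
    · exact x.2.1
    · exact (mul_assoc _ _ _).symm.trans x.2.2
  src_inv := fun _ => rfl
  tgt_inv := fun _ => rfl
  mul_inv := fun _ => rfl
  inv_mul := fun _ => rfl

/-- The set of regular elements, `a ∈ aAa`. -/
def regularElements (A : Type u) [Mul A] : Set A := {a | ∃ b, a = a * b * a}

/-- `b` is a Moore-Penrose inverse of `a`. -/
def IsMoorePenroseInverse {A : Type u} [Mul A] [Star A] (a b : A) : Prop :=
  a * b * a = a ∧ b * a * b = b ∧ star (b * a) = b * a ∧ star (a * b) = a * b

open Classical in
/-- The Moore-Penrose inverse, with value `0` where there is none. -/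
noncomputable def moorePenroseInverse {A : Type u} [Mul A] [Star A] [Zero A] (a : A) : A :=
  if h : ∃ b, IsMoorePenroseInverse a b then h.choose else 0

/-! ### Partial isometries in `C^*`-algebras -/

/-- The set `𝒫(A)` of orthogonal projections. -/
def orthogonalProjections (A : Type u) [Mul A] [Star A] : Set A := {p | p * p = p ∧ star p = p}

/-- The set `𝒰(A)` of partial isometries. -/
def partialIsometries (A : Type u) [Mul A] [Star A] : Set A :=
  {a | a * star a ∈ orthogonalProjections A ∧ star a * a ∈ orthogonalProjections A}

theorem orthogonalProjections_subset_idempotents (A : Type u) [Mul A] [Star A] :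
    orthogonalProjections A ⊆ idempotents A := fun _ h => h.1

/-- A partial isometry in a `C^*`-algebra satisfies `a a^* a = a`. -/
theorem mul_star_mul_of_mem_partialIsometries {A : Type u} [CStarAlgebra A] {a : A}
    (ha : a ∈ partialIsometries A) : a * star a * a = a := by
  have h : star a * a * (star a * a) = star a * a := ha.2.1
  rw [← sub_eq_zero, ← CStarRing.star_mul_self_eq_zero_iff]
  have e : star (a * star a * a - a) * (a * star a * a - a) =
      star a * a * (star a * a) * (star a * a) - star a * a * (star a * a)
        - star a * a * (star a * a) + star a * a := by
    simp only [star_sub, star_mul, star_star]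
    noncomm_ring
  rw [e, h, h]
  simp

/-- The groupoid `𝒰(A) ⇉ 𝒫(A)` with `s(a) = a^* a`, `t(a) = a a^*`. -/
def partialIsometriesGroupoid (A : Type u) [CStarAlgebra A] :
    GroupoidOver (partialIsometries A) (orthogonalProjections A) where
  src := fun a => ⟨star a.1 * a.1, a.2.2⟩
  tgt := fun a => ⟨a.1 * star a.1, a.2.1⟩
  mul := fun a b w => ⟨a.1 * b.1, by
    have w' : star a.1 * a.1 = b.1 * star b.1 := congrArg Subtype.val w
    have ea := mul_star_mul_of_mem_partialIsometries a.2
    have eb := mul_star_mul_of_mem_partialIsometries b.2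
    have h1 : a.1 * b.1 * star (a.1 * b.1) = a.1 * star a.1 := by
      calc a.1 * b.1 * star (a.1 * b.1) = a.1 * (b.1 * star b.1) * star a.1 := by
            simp only [star_mul, mul_assoc]
        _ = a.1 * star a.1 * a.1 * star a.1 := by rw [← w']; simp only [mul_assoc]
        _ = a.1 * star a.1 := by rw [ea]
    have h2 : star (a.1 * b.1) * (a.1 * b.1) = star b.1 * b.1 := by
      calc star (a.1 * b.1) * (a.1 * b.1) = star b.1 * (star a.1 * a.1) * b.1 := by
            simp only [star_mul, mul_assoc]
        _ = star b.1 * (b.1 * star b.1 * b.1) := by rw [w']; simp only [mul_assoc]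
        _ = star b.1 * b.1 := by rw [eb]
    constructor
    · rw [h1]; exact a.2.1
    · rw [h2]; exact b.2.2⟩
  one := fun p => ⟨p.1, by
    have h1 : p.1 * p.1 = p.1 := p.2.1
    have h2 : star p.1 = p.1 := p.2.2
    constructor
    · rw [h2, h1]; exact p.2
    · rw [h2, h1]; exact p.2⟩
  inv := fun a => ⟨star a.1, by
    constructor
    · rw [star_star]; exact a.2.2
    · rw [star_star]; exact a.2.1⟩
  src_mul := fun a b w => by
    have w' : star a.1 * a.1 = b.1 * star b.1 := congrArg Subtype.val w
    have eb := mul_star_mul_of_mem_partialIsometries b.2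
    refine Subtype.ext ?_
    change star (a.1 * b.1) * (a.1 * b.1) = star b.1 * b.1
    calc star (a.1 * b.1) * (a.1 * b.1) = star b.1 * (star a.1 * a.1) * b.1 := by
          simp only [star_mul, mul_assoc]
      _ = star b.1 * (b.1 * star b.1 * b.1) := by rw [w']; simp only [mul_assoc]
      _ = star b.1 * b.1 := by rw [eb]
  tgt_mul := fun a b w => by
    have w' : star a.1 * a.1 = b.1 * star b.1 := congrArg Subtype.val w
    have ea := mul_star_mul_of_mem_partialIsometries a.2
    refine Subtype.ext ?_
    change a.1 * b.1 * star (a.1 * b.1) = a.1 * star a.1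
    calc a.1 * b.1 * star (a.1 * b.1) = a.1 * (b.1 * star b.1) * star a.1 := by
          simp only [star_mul, mul_assoc]
      _ = a.1 * star a.1 * a.1 * star a.1 := by rw [← w']; simp only [mul_assoc]
      _ = a.1 * star a.1 := by rw [ea]
  mul_assoc := fun a b c _ _ => Subtype.ext (mul_assoc a.1 b.1 c.1)
  src_one := fun p => Subtype.ext (by
    have h1 : p.1 * p.1 = p.1 := p.2.1
    have h2 : star p.1 = p.1 := p.2.2
    change star p.1 * p.1 = p.1
    rw [h2, h1])
  tgt_one := fun p => Subtype.ext (by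
    have h1 : p.1 * p.1 = p.1 := p.2.1
    have h2 : star p.1 = p.1 := p.2.2
    change p.1 * star p.1 = p.1
    rw [h2, h1])
  mul_one := fun a => Subtype.ext
    ((mul_assoc _ _ _).symm.trans (mul_star_mul_of_mem_partialIsometries a.2))
  one_mul := fun a => Subtype.ext (mul_star_mul_of_mem_partialIsometries a.2)
  src_inv := fun a => Subtype.ext (by
    change star (star a.1) * star a.1 = a.1 * star a.1
    rw [star_star])
  tgt_inv := fun a => Subtype.ext (by
    change star a.1 * star (star a.1) = star a.1 * a.1
    rw [star_star])
  mul_inv := fun _ => rfl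
  inv_mul := fun _ => rfl

/-! Part (ii) rests on a formula for range projections: for an idempotent `p` in a `C^*`-algebra, `p
+ p^* - 1` is invertible and `p (p + p^* - 1)⁻¹` is the orthogonal projection with the same range,
so it depends continuously on `p`. Suppose `a_n → a` and `a_n† a_n → a† a`. A perturbation of `a†`
yields `c_n → a†` with `c_n a_n = a_n† a_n`. Then `a_n c_n` is an idempotent with range projection
`a_n a_n†`, and `a_n† = (a_n† a_n) c_n (a_n a_n†)` converges (`tendsto_moorePenroseInverse`); no
norm bound on `a_n†` enters. The converse is continuity of the source map.

For (iii), each of the four sets is locally the image of an analytic retraction of the ambient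
Banach space (`IsLocalRetract`). Straightening such a retraction gives charts that are restrictions
of affine projections, so ambient smooth maps restrict to smooth maps, and a map with smooth local
sections is a submersion (`IsLocalRetract.isSubmersion`). `IsLocalRetract.isBanachLie` combines
these facts.

The retractions and sections are built mainly from `d = e p + (1 - e)(1 - p)`, which equals `1` at
`e = p` and satisfies `d p = e d` for idempotents. In the self-adjoint setting `d` is replaced by
its unitary polar part, which still intertwines (`exists_polar`). On partial isometries the
Moore-Penrose inverse is the adjoint, so `η` becomes the restriction of the real-linear map `a ↦ (a,
a^*)`. -/

/-! ### Submanifolds given by local retractions -/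

section LocalRetract

variable {E : Type u} [NormedAddCommGroup E] [NormedSpace ℝ E]

/-- The set `S` is, locally, the set of fixed points of an analytic retraction. -/
def IsLocalRetract (S : Set E) : Prop :=
  ∀ x ∈ S, ∃ r : E → E, ContDiffAt ℝ ω r x ∧ ∀ᶠ y in 𝓝 x, r y ∈ S ∧ (y ∈ S → r y = y)

/-- A chart of `S` around `x` that is the restriction of a linear projection onto the tangent
space at `x`. -/
structure TangentChart (S : Set E) (x : S) where
  model : Submodule ℝ E
  proj : E →L[ℝ] model
  proj_coe : ∀ v : model, proj v = v
  chart : OpenPartialHomeomorph S model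
  mem_source : x ∈ chart.source
  chart_apply : ∀ y : S, chart y = proj (y - x)
  contDiffOn_symm : ContDiffOn ℝ ∞ (fun v => (chart.symm v : E)) chart.target
  hasFDerivAt_symm : HasFDerivAt (fun v => (chart.symm v : E)) model.subtypeL 0

/-- Differentiating `r ∘ r = r` at the fixed point `x` makes `P = Dr(x)` idempotent. The inverse
function theorem then flattens `S` onto the range of `P`. -/
theorem exists_straightening [CompleteSpace E] {S : Set E} {x : E} (hx : x ∈ S) {r : E → E}
    (hr : ContDiffAt ℝ ω r x) (h : ∀ᶠ y in 𝓝 x, r y ∈ S ∧ (y ∈ S → r y = y)) :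
    ∃ (P : E →L[ℝ] E) (Φ : OpenPartialHomeomorph E E), (∀ v, P (P v) = P v) ∧ x ∈ Φ.source ∧
      (∀ y ∈ Φ.source, y ∈ S → Φ y = P (y - x)) ∧
      (∀ y ∈ Φ.source, P (Φ y) = Φ y → y ∈ S) ∧
      ContDiffOn ℝ ∞ Φ.symm Φ.target ∧ HasFDerivAt Φ.symm (ContinuousLinearMap.id ℝ E) 0 := by
  have hrx : r x = x := h.self_of_nhds.2 hx
  have hrc : Tendsto r (𝓝 x) (𝓝 x) := by simpa [hrx] using hr.continuousAt.tendsto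
  have hrr : ∀ᶠ y in 𝓝 x, r (r y) = r y := by
    filter_upwards [h, hrc.eventually h] with y h1 h2 using h2.2 h1.1
  set P : E →L[ℝ] E := fderiv ℝ r x
  have hP : HasFDerivAt r P x := (hr.differentiableAt (by simp)).hasFDerivAt
  have hPP : P ∘L P = P := by
    have h1 : HasFDerivAt (fun y => r (r y)) (P ∘L P) x :=
      HasFDerivAt.comp x (by rwa [hrx]) hP
    exact (h1.congr_of_eventuallyEq (hrr.mono fun y hy => hy.symm)).unique hP
  have hPP' : ∀ v, P (P v) = P v := fun v => congrArg (fun T : E →L[ℝ] E => T v) hPP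
  -- The two summands lie in the range and in the kernel of `P`. The derivative at `x` is `P + (1 -
  -- P) = 1`, and on `S` the second summand vanishes.
  let f : E → E := fun y => P (r y - x) + ((y - r y) - P (y - r y))
  have hfx : f x = 0 := by simp [f, hrx]
  have hfc : ContDiffAt ℝ ω f x := by
    have h1 : ContDiffAt ℝ ω (fun y => P (r y - x)) x :=
      P.contDiff.contDiffAt.comp x (hr.sub contDiffAt_const)
    have h2 : ContDiffAt ℝ ω (fun y => y - r y) x := contDiffAt_id.sub hr
    exact h1.add (h2.sub (P.contDiff.contDiffAt.comp x h2))
  have hfd : HasFDerivAt f ((ContinuousLinearEquiv.refl ℝ E : E ≃L[ℝ] E) : E →L[ℝ] E) x := by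
    have h1 : HasFDerivAt (fun y => P (r y - x)) (P ∘L P) x :=
      P.hasFDerivAt.comp x (hP.sub_const x)
    have h2 : HasFDerivAt (fun y => y - r y) (ContinuousLinearMap.id ℝ E - P) x :=
      (hasFDerivAt_id x).sub hP
    refine (h1.add (h2.sub (P.hasFDerivAt.comp x h2))).congr_fderiv ?_
    ext v
    simp [hPP']
  let Ψ := hfc.toOpenPartialHomeomorph f hfd (by simp)
  have hΨ : ∀ y, Ψ y = f y := fun _ => rfl
  have hxΨ : x ∈ Ψ.source := hfc.mem_toOpenPartialHomeomorph_source hfd (by simp)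
  have hxs : Ψ.symm (f x) = x := Ψ.left_inv hxΨ
  have hxt : f x ∈ Ψ.target := Ψ.map_source hxΨ
  have hsymm : ContDiffAt ℝ ω Ψ.symm (f x) := hfc.to_localInverse hfd (by simp)
  have hsd : HasFDerivAt Ψ.symm (ContinuousLinearMap.id ℝ E) (f x) :=
    Ψ.hasFDerivAt_symm (f' := ContinuousLinearEquiv.refl ℝ E) hxt (by rw [hxs]; exact hfd)
  -- Here analyticity matters: it spreads from a point to a neighbourhood, whereas being `C^∞` at a
  -- point, as defined by `ContDiffAt`, need not.
  have hgood : ∀ᶠ y in 𝓝 x, (r y ∈ S ∧ (y ∈ S → r y = y)) ∧ r (r y) = r y ∧ r y ∈ Ψ.source ∧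
      ContDiffAt ℝ ω Ψ.symm (f y) :=
    h.and (hrr.and ((hrc.eventually (Ψ.open_source.mem_nhds hxΨ)).and
      (hfc.continuousAt.eventually (hsymm.eventually (by simp)))))
  obtain ⟨W, hW, hWo, hxW⟩ := mem_nhds_iff.1 hgood
  refine ⟨P, Ψ.restrOpen W hWo, hPP', ⟨hxΨ, hxW⟩, ?_, ?_, ?_, ?_⟩
  · rintro y ⟨-, hy⟩ hyS
    have h1 : r y = y := (hW hy).1.2 hyS
    change f y = _
    simp [f, h1]
  · rintro y ⟨hys, hy⟩ hPy
    obtain ⟨⟨hrS, -⟩, h2, h3, -⟩ := hW hy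
    change P (f y) = f y at hPy
    -- If `f y` lies in the range of `P`, its kernel part is zero, so `y` and `r y` have the same
    -- image; injectivity of `Ψ` puts `y = r y` in `S`.
    have h4 : f y = f (r y) := by
      rw [← hPy]
      simp [f, h2, hPP']
    rw [Ψ.injOn hys h3 h4]
    exact hrS
  · intro v hv
    have h3 := (hW ((Ψ.restrOpen W hWo).symm.map_source hv).2).2.2.2
    have h2 := (Ψ.restrOpen W hWo).right_inv hv
    change f (Ψ.symm v) = v at h2
    change ContDiffAt ℝ ω Ψ.symm (f (Ψ.symm v)) at h3
    rw [h2] at h3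
    exact (h3.of_le le_top).contDiffWithinAt
  · rw [← hfx]
    exact hsd

theorem IsLocalRetract.nonempty_tangentChart [CompleteSpace E] {S : Set E} (hS : IsLocalRetract S)
    (x : S) : Nonempty (TangentChart S x) := by
  obtain ⟨r, hr, h⟩ := hS x x.2
  obtain ⟨P, Φ, hPP, hx, h1, h2, h3, h4⟩ := exists_straightening x.2 hr h
  let F : Submodule ℝ E := LinearMap.eqLocus (P : E →ₗ[ℝ] E) LinearMap.id
  let π : E →L[ℝ] F := P.codRestrict F hPP
  have hx0 : Φ x = 0 := by simp [h1 x hx x.2]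
  have h0t : (0 : E) ∈ Φ.target := hx0 ▸ Φ.map_source hx
  have hsymm : ∀ v : F, (v : E) ∈ Φ.target → Φ.symm v ∈ S := fun v hv =>
    h2 _ (Φ.map_target hv) (by rw [Φ.right_inv hv]; exact v.2)
  classical
  let inv : F → S := fun v => if hv : (v : E) ∈ Φ.target then ⟨Φ.symm v, hsymm v hv⟩ else x
  have hinv : ∀ v : F, (v : E) ∈ Φ.target → (inv v : E) = Φ.symm v := fun v hv => by
    simp only [inv, dif_pos hv]
  have hinv0 : (fun v : F => (inv v : E)) =ᶠ[𝓝 0] fun v => Φ.symm v := by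
    filter_upwards [(Φ.open_target.preimage continuous_subtype_val).mem_nhds
      (show ((0 : F) : E) ∈ Φ.target from h0t)] with v hv using hinv v hv
  have hch : ∀ y : S, (y : E) ∈ Φ.source → ((π (y - x) : F) : E) = Φ y := fun y hy =>
    (h1 y hy y.2).symm
  refine ⟨{ model := F
            proj := π
            proj_coe := fun v => Subtype.ext v.2
            chart :=
            { toFun := fun y => π (y - x)
              invFun := inv
              source := Subtype.val ⁻¹' Φ.source
              target := Subtype.val ⁻¹' Φ.target
              map_source' := fun y hy => by
                change ((π (y - x) : F) : E) ∈ Φ.target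
                rw [hch y hy]
                exact Φ.map_source hy
              map_target' := fun v hv => by
                change (inv v : E) ∈ Φ.source
                rw [hinv v hv]
                exact Φ.map_target hv
              left_inv' := fun y hy => by
                refine Subtype.ext ?_
                rw [hinv _ (by rw [hch y hy]; exact Φ.map_source hy), hch y hy, Φ.left_inv hy]
              right_inv' := fun v hv => by
                have : (inv v : E) ∈ Φ.source := by
                  rw [hinv v hv]
                  exact Φ.map_target hv
                refine Subtype.ext ?_
                rw [hch _ this, hinv v hv, Φ.right_inv hv]
              continuousOn_toFun := by fun_prop
              continuousOn_invFun := by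
                rw [Topology.IsInducing.subtypeVal.continuousOn_iff]
                refine ContinuousOn.congr (f := fun v : F => Φ.symm v) ?_ fun v hv => hinv v hv
                exact Φ.continuousOn_symm.comp continuous_subtype_val.continuousOn fun v hv => hv
              open_source := Φ.open_source.preimage continuous_subtype_val
              open_target := Φ.open_target.preimage continuous_subtype_val }
            mem_source := hx
            chart_apply := fun y => rfl
            contDiffOn_symm := ?_
            hasFDerivAt_symm := ?_ }⟩
  · refine ContDiffOn.congr (f := fun v : F => Φ.symm v) ?_ fun v hv => hinv v hv
    exact h3.comp F.subtypeL.contDiff.contDiffOn fun v hv => hv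
  · refine HasFDerivAt.congr_of_eventuallyEq (f := fun v : F => Φ.symm v) ?_ hinv0
    exact HasFDerivAt.comp (0 : F) (g := Φ.symm) (f := F.subtypeL) (by simpa using h4)
      F.subtypeL.hasFDerivAt

namespace TangentChart

variable {S : Set E} {x : S} (c : TangentChart S x)

theorem completeSpace_model [CompleteSpace E] : CompleteSpace c.model := by
  have h : IsClosed (c.model : Set E) := by
    have : (c.model : Set E) = {v | (c.proj v : E) = v} := by
      ext v
      constructor
      · intro hv
        exact congrArg Subtype.val (c.proj_coe ⟨v, hv⟩)
      · intro hv
        rw [← show (c.proj v : E) = v from hv]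
        exact (c.proj v).2
    rw [this]
    exact isClosed_eq (by fun_prop) continuous_id
  exact h.completeSpace_coe

theorem chart_self : c.chart x = 0 := by simp [c.chart_apply]

theorem zero_mem_target : (0 : c.model) ∈ c.chart.target :=
  c.chart_self ▸ c.chart.map_source c.mem_source

theorem symm_zero : c.chart.symm 0 = x := by
  rw [← c.chart_self, c.chart.left_inv c.mem_source]

theorem contDiffAt_symm : ContDiffAt ℝ ∞ (fun v => (c.chart.symm v : E)) 0 :=
  c.contDiffOn_symm.contDiffAt (c.chart.open_target.mem_nhds c.zero_mem_target)

end TangentChart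

end LocalRetract

/-! ### Local sections -/

section LocalSections

variable {E : Type u} [NormedAddCommGroup E] [NormedSpace ℝ E] {S : Set E}
  {E' : Type u} [NormedAddCommGroup E'] [NormedSpace ℝ E'] {T : Set E'}

/-- The map `f` has smooth local sections through each point. -/
def HasLocalSections (f : S → T) : Prop :=
  ∀ x : S, ∃ σ : E' → E, ContDiffAt ℝ ω σ (f x) ∧ σ (f x) = x ∧
    ∀ᶠ y in 𝓝 (f x : E'), y ∈ T → ∃ h : σ y ∈ S, (f ⟨σ y, h⟩ : E') = y

/-- A point `y` of `T` near `f x` is the image of `σ y`, which is close to `σ (f x) = x`. -/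
theorem HasLocalSections.isOpenMap {f : S → T} (hf : HasLocalSections f) : IsOpenMap f := by
  rw [isOpenMap_iff_nhds_le]
  intro x V hV
  obtain ⟨σ, h1, h2, h3⟩ := hf x
  rw [mem_map, mem_nhds_subtype] at hV
  obtain ⟨W, hW, hWV⟩ := hV
  have h4 : Tendsto σ (𝓝 (f x : E')) (𝓝 x) := by
    have := h1.continuousAt.tendsto
    rwa [h2] at this
  have h5 : Tendsto (Subtype.val : T → E') (𝓝 (f x)) (𝓝 (f x : E')) :=
    continuous_subtype_val.continuousAt
  filter_upwards [h5.eventually (h4.eventually hW), h5.eventually h3] with y hy1 hy2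
  obtain ⟨h6, h7⟩ := hy2 y.2
  have h8 : f ⟨σ y, h6⟩ ∈ V := hWV hy1
  rwa [Subtype.ext h7] at h8

end LocalSections

/-! ### The manifold structure of a local retract -/

namespace BanachManifold

section Smooth

variable {M : Type u} [TopologicalSpace M] {N : Type u} [TopologicalSpace N]
  {E : Type u} [NormedAddCommGroup E] [NormedSpace ℝ E] [CompleteSpace E]
  {E' : Type u} [NormedAddCommGroup E'] [NormedSpace ℝ E'] [CompleteSpace E']

theorem smoothAt_ofBanachSpace_iff {X : BanachManifold M} {f : M → E} {x : M} :
    SmoothAt X (ofBanachSpace E) f x ↔ ContinuousAt f x ∧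
      ContDiffAt ℝ ∞ (fun e => f ((X.chart (X.idx x)).symm e)) (X.chart (X.idx x) x) :=
  Iff.rfl

theorem SmoothAt.congr_of_eventuallyEq {X : BanachManifold M} {f g : M → E} {x : M}
    (hf : SmoothAt X (ofBanachSpace E) f x) (h : g =ᶠ[𝓝 x] f) :
    SmoothAt X (ofBanachSpace E) g x := by
  rw [smoothAt_ofBanachSpace_iff] at hf ⊢
  refine ⟨hf.1.congr h.symm, hf.2.congr_of_eventuallyEq ?_⟩
  have hx : x ∈ (X.chart (X.idx x)).source := X.mem_source x
  have h1 : Tendsto (X.chart (X.idx x)).symm (𝓝 (X.chart (X.idx x) x)) (𝓝 x) :=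
    ((X.chart (X.idx x)).tendsto_symm hx)
  exact h1.eventually h

theorem SmoothAt.postcomp {X : BanachManifold M} {f : M → E} {x : M}
    (hf : SmoothAt X (ofBanachSpace E) f x) {g : E → E'} (hg : ContDiffAt ℝ ∞ g (f x)) :
    SmoothAt X (ofBanachSpace E') (fun y => g (f y)) x := by
  refine ⟨ContinuousAt.comp (g := g) hg.continuousAt hf.1, ?_⟩
  refine ContDiffAt.comp (g := g) (f := inCharts X (ofBanachSpace E) f x) _ ?_ hf.2
  have hx : (X.chart (X.idx x)).symm (X.chart (X.idx x) x) = x :=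
    (X.chart (X.idx x)).left_inv (X.mem_source x)
  change ContDiffAt ℝ ∞ g (f ((X.chart (X.idx x)).symm (X.chart (X.idx x) x)))
  rwa [hx]

theorem SmoothAt.prodMap {X : BanachManifold M} {Y : BanachManifold N} {f : M → E} {g : N → E'}
    {z : M × N} (hf : SmoothAt X (ofBanachSpace E) f z.1)
    (hg : SmoothAt Y (ofBanachSpace E') g z.2) :
    SmoothAt (X.prod Y) (ofBanachSpace (E × E')) (Prod.map f g) z := by
  refine ⟨hf.1.prodMap hg.1, ?_⟩
  exact (ContDiffAt.comp (X.chart (X.idx z.1) z.1, Y.chart (Y.idx z.2) z.2) hf.2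
    contDiffAt_fst).prodMk (ContDiffAt.comp (X.chart (X.idx z.1) z.1, Y.chart (Y.idx z.2) z.2) hg.2
    contDiffAt_snd)

end Smooth

end BanachManifold

namespace IsLocalRetract

open BanachManifold

variable {E : Type u} [NormedAddCommGroup E] [NormedSpace ℝ E] [CompleteSpace E] {S : Set E}
  {E' : Type u} [NormedAddCommGroup E'] [NormedSpace ℝ E'] [CompleteSpace E'] {T : Set E'}

/-- A chart around a point of a local retract. -/
noncomputable def tangentChart (hS : IsLocalRetract S) (x : S) : TangentChart S x :=
  (hS.nonempty_tangentChart x).some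

/-- The manifold structure of a local retract. -/
noncomputable def manifold (hS : IsLocalRetract S) : BanachManifold S where
  ι := S
  model := fun x => (hS.tangentChart x).model
  completeSpace := fun x => (hS.tangentChart x).completeSpace_model
  chart := fun x => (hS.tangentChart x).chart
  idx := id
  mem_source := fun x => (hS.tangentChart x).mem_source
  contDiffOn_transition := fun x y => by
    have h : ContDiffOn ℝ ∞ (fun e => (hS.tangentChart y).proj
        (((hS.tangentChart x).chart.symm e : E) - y)) (hS.tangentChart x).chart.target :=
      (hS.tangentChart y).proj.contDiff.comp_contDiffOn
        ((hS.tangentChart x).contDiffOn_symm.sub contDiffOn_const)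
    refine (h.mono fun e he => he.1).congr fun e _ => ?_
    exact (hS.tangentChart y).chart_apply _

theorem smoothAt_coe (hS : IsLocalRetract S) (x : S) :
    SmoothAt hS.manifold (ofBanachSpace E) (Subtype.val : S → E) x := by
  refine ⟨continuous_subtype_val.continuousAt, ?_⟩
  change ContDiffAt ℝ ∞ (fun v => ((hS.tangentChart x).chart.symm v : E))
    ((hS.tangentChart x).chart x)
  rw [TangentChart.chart_self]
  exact (hS.tangentChart x).contDiffAt_symm

/-- The charts of `S` are restrictions of continuous affine maps of `E`, so smoothness into `S` can
be tested in `E`. -/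
theorem smoothAt_of_coe {M : Type u} [TopologicalSpace M] {X : BanachManifold M}
    (hS : IsLocalRetract S) {f : M → S} {x : M}
    (hf : SmoothAt X (ofBanachSpace E) (fun y => (f y : E)) x) : SmoothAt X hS.manifold f x := by
  rw [smoothAt_ofBanachSpace_iff] at hf
  refine ⟨Topology.IsInducing.subtypeVal.continuousAt_iff.2 hf.1, ?_⟩
  have h : inCharts X hS.manifold f x = fun e => (hS.tangentChart (f x)).proj
      ((f ((X.chart (X.idx x)).symm e) : E) - f x) :=
    funext fun e => (hS.tangentChart (f x)).chart_apply _
  rw [h]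
  exact (hS.tangentChart (f x)).proj.contDiff.contDiffAt.comp _ (hf.2.sub contDiffAt_const)

theorem smooth_of_extension (hS : IsLocalRetract S) (hT : IsLocalRetract T) {f : S → T}
    {g : E → E'} (hg : ContDiff ℝ ∞ g) (hfg : ∀ x, (f x : E') = g x) :
    Smooth hS.manifold hT.manifold f := fun x => by
  refine hT.smoothAt_of_coe ?_
  simp only [hfg]
  exact (hS.smoothAt_coe x).postcomp hg.contDiffAt

/-- The chart at `x` is centred at `0`, and its inverse has the inclusion of the model as derivative
there; the chain rule does the rest. -/
theorem hasFDerivAt_inCharts (hS : IsLocalRetract S) (hT : IsLocalRetract T) {f : S → T}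
    {g : E → E'} {g' : E →L[ℝ] E'} {x : S} (hg : HasFDerivAt g g' x)
    (hfg : ∀ x, (f x : E') = g x) :
    HasFDerivAt (inCharts hS.manifold hT.manifold f x : (hS.tangentChart x).model →
        (hT.tangentChart (f x)).model)
      ((hT.tangentChart (f x)).proj ∘L g' ∘L (hS.tangentChart x).model.subtypeL) 0 := by
  have h : (inCharts hS.manifold hT.manifold f x : (hS.tangentChart x).model →
        (hT.tangentChart (f x)).model) = fun e => (hT.tangentChart (f x)).proj
      (g ((hS.tangentChart x).chart.symm e) - f x) :=
    funext fun e => by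
      rw [← hfg]
      exact (hT.tangentChart (f x)).chart_apply _
  rw [h]
  refine (hT.tangentChart (f x)).proj.hasFDerivAt.comp _ (HasFDerivAt.sub_const _ ?_)
  refine HasFDerivAt.comp (0 : (hS.tangentChart x).model) (g := g) ?_
    (hS.tangentChart x).hasFDerivAt_symm
  rwa [TangentChart.symm_zero]

theorem tangentMapAt_eq (hS : IsLocalRetract S) (hT : IsLocalRetract T) {f : S → T}
    {g : E → E'} {g' : E →L[ℝ] E'} {x : S} (hg : HasFDerivAt g g' x)
    (hfg : ∀ x, (f x : E') = g x) :
    tangentMapAt hS.manifold hT.manifold f x =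
      (hT.tangentChart (f x)).proj ∘L g' ∘L (hS.tangentChart x).model.subtypeL := by
  refine HasFDerivAt.fderiv (f := (inCharts hS.manifold hT.manifold f x :
    (hS.tangentChart x).model → (hT.tangentChart (f x)).model))
    (x := (hS.tangentChart x).chart x) ?_
  rw [TangentChart.chart_self]
  exact hS.hasFDerivAt_inCharts hT hg hfg

theorem isSubmanifold (hS : IsLocalRetract S) (hc : IsClosed S) :
    hS.manifold.IsSubmanifold := by
  have ht : ∀ x, tangentMapAt hS.manifold (ofBanachSpace E) (Subtype.val : S → E) x =
      (hS.tangentChart x).model.subtypeL := fun x => by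
    have h := (hS.tangentChart x).hasFDerivAt_symm
    rw [← (hS.tangentChart x).chart_self] at h
    exact h.fderiv
  refine ⟨hc, hS.smoothAt_coe, fun x => ?_, fun x => ?_⟩
  · rw [ht]
    exact Subtype.val_injective
  · rw [ht]
    exact ContinuousLinearMap.closedComplemented_range_of_leftInverse
      (hS.tangentChart x).model.subtypeL (hS.tangentChart x).proj (hS.tangentChart x).proj_coe

/-- The derivative of a local section through `x` gives a continuous right inverse of the tangent
map, which yields both surjectivity and a complement of the kernel. -/
theorem isSubmersion (hS : IsLocalRetract S) (hT : IsLocalRetract T) {f : S → T}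
    {g : E → E'} (hg : ContDiff ℝ ∞ g) (hfg : ∀ x, (f x : E') = g x)
    (hsurj : Function.Surjective f) (hf : HasLocalSections f) :
    IsSubmersion hS.manifold hT.manifold f := by
  have key : ∀ x, ∃ R : (hT.tangentChart (f x)).model →L[ℝ] (hS.tangentChart x).model,
      Function.RightInverse R (tangentMapAt hS.manifold hT.manifold f x) := fun x => by
    set c := hS.tangentChart x
    set d := hT.tangentChart (f x)
    obtain ⟨σ, h1, h2, h3⟩ := hf x
    have hσ : HasFDerivAt σ (fderiv ℝ σ (f x)) (f x) :=
      (h1.differentiableAt (by simp)).hasFDerivAt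
    set σ' := fderiv ℝ σ (f x)
    have hg' : HasFDerivAt g (fderiv ℝ g x) x :=
      (hg.contDiffAt.differentiableAt (by simp)).hasFDerivAt
    set g' := fderiv ℝ g x
    refine ⟨c.proj ∘L σ' ∘L d.model.subtypeL, fun w => ?_⟩
    have hd : Tendsto (fun v => (d.chart.symm v : E')) (𝓝 0) (𝓝 (f x)) := by
      have := d.hasFDerivAt_symm.continuousAt.tendsto
      rwa [d.symm_zero] at this
    have hγ : HasFDerivAt (fun v => σ (d.chart.symm v)) (σ' ∘L d.model.subtypeL) 0 := by
      refine HasFDerivAt.comp (0 : d.model) (g := σ) ?_ d.hasFDerivAt_symm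
      rwa [d.symm_zero]
    have hγ0 : σ (d.chart.symm 0) = x := by rw [d.symm_zero, h2]
    have hin : ∀ᶠ v in 𝓝 (0 : d.model), ∃ h : σ (d.chart.symm v) ∈ S,
        (f ⟨σ (d.chart.symm v), h⟩ : E') = d.chart.symm v :=
      (hd.eventually h3).mono fun v hv => hv (d.chart.symm v).2
    -- the section composed with the projection
    have e1 : g' ∘L σ' ∘L d.model.subtypeL = d.model.subtypeL := by
      have a1 : HasFDerivAt (fun v => g (σ (d.chart.symm v))) (g' ∘L σ' ∘L d.model.subtypeL) 0 :=
        HasFDerivAt.comp (0 : d.model) (g := g) (by rwa [hγ0]) hγ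
      refine (a1.congr_of_eventuallyEq ?_).unique d.hasFDerivAt_symm
      filter_upwards [hin] with v ⟨hv1, hv2⟩
      exact hv2.symm.trans (hfg _)
    -- the derivative of the section takes values in the tangent space
    have e2 : c.model.subtypeL ∘L c.proj ∘L σ' ∘L d.model.subtypeL = σ' ∘L d.model.subtypeL := by
      have a1 : HasFDerivAt (fun v => c.proj (σ (d.chart.symm v) - x))
          (c.proj ∘L σ' ∘L d.model.subtypeL) 0 :=
        c.proj.hasFDerivAt.comp _ (hγ.sub_const _)
      have a2 : HasFDerivAt (fun v => (c.chart.symm (c.proj (σ (d.chart.symm v) - x)) : E))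
          (c.model.subtypeL ∘L c.proj ∘L σ' ∘L d.model.subtypeL) 0 := by
        refine HasFDerivAt.comp (0 : d.model) (g := fun w => (c.chart.symm w : E)) ?_ a1
        rw [hγ0, sub_self, map_zero]
        exact c.hasFDerivAt_symm
      refine (a2.congr_of_eventuallyEq ?_).unique hγ
      obtain ⟨W, hW, hWs⟩ := mem_nhds_subtype _ _ _ |>.1 (c.chart.open_source.mem_nhds c.mem_source)
      have hγc : Tendsto (fun v => σ (d.chart.symm v)) (𝓝 0) (𝓝 x) := by
        have := hγ.continuousAt.tendsto
        rwa [hγ0] at this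
      filter_upwards [hin, hγc.eventually hW] with v ⟨hv1, _⟩ hv2
      have a3 := c.chart.left_inv (hWs (show (⟨_, hv1⟩ : S) ∈ Subtype.val ⁻¹' W from hv2))
      rw [c.chart_apply] at a3
      rw [a3]
    have e3 : tangentMapAt hS.manifold hT.manifold f x = d.proj ∘L g' ∘L c.model.subtypeL :=
      hS.tangentMapAt_eq hT hg' hfg
    have e4 : (d.proj ∘L g' ∘L c.model.subtypeL) ((c.proj ∘L σ' ∘L d.model.subtypeL) w) = w := by
      have b1 := congrArg (fun L : d.model →L[ℝ] E => L w) e2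
      have b2 := congrArg (fun L : d.model →L[ℝ] E' => L w) e1
      simp only [ContinuousLinearMap.comp_apply] at b1 b2 ⊢
      rw [b1, b2]
      exact d.proj_coe w
    rw [e3]
    exact e4
  refine ⟨hsurj, hS.smooth_of_extension hT hg hfg, fun x => ?_, fun x => ?_⟩
  · obtain ⟨R, hR⟩ := key x
    exact hR.surjective
  · obtain ⟨R, hR⟩ := key x
    exact ContinuousLinearMap.closedComplemented_ker_of_rightInverse
      (tangentMapAt hS.manifold hT.manifold f x) R hR

/-- Composing the ambient formula `g` with a local retraction onto `T` extends `m` to a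
neighbourhood in `S × S`. No manifold structure on `C` is needed. -/
theorem smoothOnSubset (hS : IsLocalRetract S) (hT : IsLocalRetract T) {C : Set (S × S)}
    {m : C → T} {g : E × E → E'} (hg : ContDiff ℝ ω g)
    (hmg : ∀ z : C, (m z : E') = g (z.1.1, z.1.2)) :
    (hS.manifold.prod hS.manifold).SmoothOnSubset hT.manifold m := by
  intro z
  let ι : S × S → E × E := Prod.map Subtype.val Subtype.val
  have hι : ∀ y, SmoothAt (hS.manifold.prod hS.manifold) (ofBanachSpace (E × E)) ι y := fun y =>
    SmoothAt.prodMap (z := y) (hS.smoothAt_coe y.1) (hS.smoothAt_coe y.2)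
  have hιc : Continuous ι := continuous_subtype_val.prodMap continuous_subtype_val
  have hgι : Tendsto (fun y => g (ι y)) (𝓝 z.1) (𝓝 (m z)) := by
    rw [hmg]
    exact (hg.continuous.comp hιc).continuousAt
  obtain ⟨r, hr, h⟩ := hT (m z) (m z).2
  classical
  -- The default `m z` only makes `F` total; near `z` the first branch always applies.
  let F : S × S → T := fun y => if hy : r (g (ι y)) ∈ T then ⟨_, hy⟩ else m z
  have hF : ∀ᶠ y in 𝓝 z.1, (F y : E') = r (g (ι y)) :=
    (hgι.eventually h).mono fun y hy => by simp only [F, dif_pos hy.1]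
  refine ⟨F, ?_, ?_⟩
  · filter_upwards [hF.eventually_nhds, hgι.eventually (hr.eventually (by simp))] with y hy1 hy2
    refine hT.smoothAt_of_coe (SmoothAt.congr_of_eventuallyEq ?_ hy1)
    exact (hι y).postcomp (g := fun e => r (g e))
      ((hy2.of_le le_top).comp (ι y) (hg.contDiffAt.of_le le_top))
  · filter_upwards [hF, hgι.eventually h] with y hy1 hy2 hyC
    refine Subtype.ext ?_
    have h1 := hmg ⟨y, hyC⟩
    have h2 : g (ι y) ∈ T := by
      rw [show g (ι y) = m ⟨y, hyC⟩ from h1.symm]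
      exact (m _).2
    rw [hy1, hy2.2 h2]
    exact h1.symm

end IsLocalRetract

/-! ### Moore-Penrose inverses -/

section MoorePenrose

theorem IsMoorePenroseInverse.unique {A : Type u} [Semigroup A] [StarMul A] {a b c : A}
    (hb : IsMoorePenroseInverse a b) (hc : IsMoorePenroseInverse a c) : b = c := by
  obtain ⟨b1, b2, b3, b4⟩ := hb
  obtain ⟨c1, c2, c3, c4⟩ := hc
  have h1 : a * b = a * c := by
    calc a * b = star (a * c * (a * b)) := by rw [← mul_assoc, c1, b4]
      _ = a * b * (a * c) := by rw [star_mul, b4, c4]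
      _ = a * c := by rw [← mul_assoc, b1]
  have h2 : b * a = c * a := by
    calc b * a = b * a * (c * a) := by rw [mul_assoc b a, ← mul_assoc a, c1]
      _ = star (c * a * (b * a)) := by rw [star_mul, b3, c3]
      _ = c * a := by rw [mul_assoc, ← mul_assoc a, b1, c3]
  calc b = b * (a * b) := by rw [← mul_assoc, b2]
    _ = c := by rw [h1, ← mul_assoc, h2, c2]

theorem IsMoorePenroseInverse.eq_moorePenroseInverse {A : Type u} [MonoidWithZero A] [StarMul A]
    {a b : A} (h : IsMoorePenroseInverse a b) : moorePenroseInverse a = b := by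
  have he : ∃ b, IsMoorePenroseInverse a b := ⟨b, h⟩
  rw [moorePenroseInverse, dif_pos he]
  exact he.choose_spec.unique h

/-! ### Range projections and existence of Moore-Penrose inverses. -/

variable {A : Type u} [CStarAlgebra A]

/-- The element `i m` is self-adjoint, so `i` is not in its real spectrum, and `1 - m = -i (i - i
m)`. -/
theorem isUnit_one_sub_of_star_eq_neg {m : A} (hm : star m = -m) : IsUnit (1 - m) := by
  have hs : IsSelfAdjoint (Complex.I • m) := by
    rw [IsSelfAdjoint, star_smul, hm]
    simp
  have h1 : Complex.I ∉ spectrum ℂ (Complex.I • m) := fun h => by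
    have := hs.mem_spectrum_eq_re h
    simpa using congrArg Complex.im this
  rw [spectrum.notMem_iff] at h1
  have h2 : IsUnit (algebraMap ℂ A (-Complex.I)) := (IsUnit.mk0 _ (by simp)).map _
  have h3 : 1 - m = algebraMap ℂ A (-Complex.I) *
      (algebraMap ℂ A Complex.I - Complex.I • m) := by
    simp [Algebra.algebraMap_eq_smul_one, mul_sub, smul_smul]
  rw [h3]
  exact h2.mul h1

/-- Its square is `(1 - m)(1 + m)` with `m = p - p^*` skew-adjoint. -/
theorem isUnit_add_star_sub_one {p : A} (hp : p * p = p) : IsUnit (p + star p - 1) := by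
  have hp' : star p * star p = star p := by rw [← star_mul, hp]
  have h1 : IsUnit (1 - (p - star p)) := isUnit_one_sub_of_star_eq_neg (by simp)
  have h2 : IsUnit (1 - (star p - p)) := isUnit_one_sub_of_star_eq_neg (by simp)
  have h3 : (p + star p - 1) ^ 2 = (1 - (p - star p)) * (1 - (star p - p)) := by
    simp only [pow_two, mul_sub, sub_mul, mul_add, add_mul, hp, hp', mul_one, one_mul]
    abel
  exact (isUnit_pow_iff two_ne_zero).1 (h3 ▸ h1.mul h2)

/-- Each idempotent has the same range as some orthogonal projection. -/
theorem exists_range_projection {p : A} (hp : p * p = p) :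
    ∃ e ∈ orthogonalProjections A, p * e = e ∧ e * p = p := by
  set z := p + star p - 1
  have hz : IsUnit z := isUnit_add_star_sub_one hp
  have hp' : star p * star p = star p := by rw [← star_mul, hp]
  have hzs : star z = z := by
    simp only [z, star_sub, star_add, star_star, star_one]
    abel
  have h1 : p * z = p * star p := by
    simp only [z, mul_sub, mul_add, hp, mul_one]
    abel
  have h2 : z * star p = p * star p := by
    simp only [z, sub_mul, add_mul, hp', one_mul]
    abel
  set t := Ring.inverse z
  have hzt : z * t = 1 := Ring.mul_inverse_cancel z hz
  have htz : t * z = 1 := Ring.inverse_mul_cancel z hz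
  have hts : star t = t := by
    calc star t = star t * (z * t) := by rw [hzt, mul_one]
      _ = star (z * t) * t := by rw [star_mul, hzs, mul_assoc]
      _ = t := by rw [hzt, star_one, one_mul]
  have h3 : t * p = star p * t := by
    calc t * p = t * (p * z) * t := by rw [mul_assoc, mul_assoc, hzt, mul_one]
      _ = t * z * star p * t := by rw [h1, ← h2, ← mul_assoc t]
      _ = star p * t := by rw [htz, one_mul]
  have h4 : p * t * p = p := by
    calc p * t * p = p * star p * t := by rw [mul_assoc, h3, mul_assoc]
      _ = p := by rw [← h1, mul_assoc, hzt, mul_one]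
  have h5 : star p * t * star p = star p := by
    have := congrArg star h4
    simpa only [star_mul, hts, mul_assoc] using this
  -- Self-adjointness of `p z⁻¹` comes from `p^* z = p^* p = z p`; the remaining identities use `p z
  -- = p p^* = z p^*`.
  refine ⟨p * t, ⟨?_, ?_⟩, ?_, h4⟩
  · rw [← mul_assoc, h4]
  · have h6 : star p * p = z * p := by
      simp only [z, sub_mul, add_mul, hp, one_mul]
      abel
    rw [star_mul, hts]
    calc t * star p = t * (star p * p) * t := by
          have h7 : star p * z = star p * p := by
            simp only [z, mul_sub, mul_add, hp', mul_one]
            abel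
          rw [← h7, mul_assoc, mul_assoc, hzt, mul_one]
      _ = p * t := by rw [h6, ← mul_assoc, htz, one_mul]
  · rw [← mul_assoc, hp]

/-- An inner inverse `b` is corrected on both sides: with `e` the range projection of `a b` and `f`
that of `(b a)^*`, the element `x = f b e` satisfies `a x = e` and `x a = f`. -/
theorem exists_isMoorePenroseInverse {a : A} (ha : a ∈ regularElements A) :
    ∃ b, IsMoorePenroseInverse a b := by
  obtain ⟨b, hb⟩ := ha
  obtain ⟨e, ⟨he1, he2⟩, h1, h2⟩ := exists_range_projection (p := a * b)
    (by rw [← mul_assoc, ← hb])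
  obtain ⟨f, ⟨hf1, hf2⟩, h3, h4⟩ := exists_range_projection (p := star (b * a))
    (by rw [← star_mul, mul_assoc, ← mul_assoc a, ← hb])
  have h5 : f * (b * a) = f := by
    have := congrArg star h3
    rwa [star_mul, star_star, hf2] at this
  have h6 : b * a * f = b * a := by
    have := congrArg star h4
    rwa [star_mul, star_star, hf2] at this
  have h7 : a * f = a := by
    calc a * f = a * (b * a * f) := by rw [← mul_assoc, ← mul_assoc, ← hb]
      _ = a := by rw [h6, ← mul_assoc, ← hb]
  have h8 : e * a = a := by
    calc e * a = e * (a * b) * a := by rw [mul_assoc, ← hb]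
      _ = a := by rw [h2, ← hb]
  have h9 : a * (f * b * e) = e := by
    rw [← mul_assoc, ← mul_assoc, h7, h1]
  have h10 : f * b * e * a = f := by
    rw [mul_assoc, h8, mul_assoc, h5]
  refine ⟨f * b * e, ?_, ?_, ?_, ?_⟩
  · rw [h9, h8]
  · rw [h10, ← mul_assoc, ← mul_assoc, hf1]
  · rw [h10, hf2]
  · rw [h9, he2]

theorem isMoorePenroseInverse_moorePenroseInverse {a : A} (ha : a ∈ regularElements A) :
    IsMoorePenroseInverse a (moorePenroseInverse a) := by
  obtain ⟨b, hb⟩ := exists_isMoorePenroseInverse ha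
  rwa [hb.eq_moorePenroseInverse]

/-! ### Continuity of the Moore-Penrose inverse under convergence of sources. -/

theorem mul_ringInverse_eq {x y z : A} (hz : IsUnit z) (h : x * z = y) :
    y * Ring.inverse z = x := by
  rw [← h, mul_assoc, Ring.mul_inverse_cancel _ hz, mul_one]

theorem tendsto_ringInverse_of_isUnit {α : Type*} {l : Filter α} {f : α → A} {a : A}
    (ha : IsUnit a) (hf : Tendsto f l (𝓝 a)) :
    Tendsto (fun n => Ring.inverse (f n)) l (𝓝 (Ring.inverse a)) := by
  obtain ⟨u, rfl⟩ := ha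
  exact (NormedRing.inverse_continuousAt u).tendsto.comp hf

theorem tendsto_moorePenroseInverse {α : Type*} {l : Filter α} {a b : α → A} {a₀ b₀ : A}
    (h : ∀ n, IsMoorePenroseInverse (a n) (b n)) (h₀ : IsMoorePenroseInverse a₀ b₀)
    (ha : Tendsto a l (𝓝 a₀)) (hf : Tendsto (fun n => b n * a n) l (𝓝 (b₀ * a₀))) :
    Tendsto b l (𝓝 b₀) := by
  obtain ⟨h1, h2, h3, h4⟩ := h₀
  -- Since `a_n b_n a_n = a_n`, one has `d_n (b_n a_n) = b₀ a_n`, while `d_n → 1` by convergence of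
  -- the sources. Hence `c_n = d_n⁻¹ b₀` satisfies `c_n a_n = b_n a_n` eventually.
  let d : α → A := fun n => b₀ * a n + (1 - b n * a n)
  have hd : Tendsto d l (𝓝 1) := by
    have := (ha.const_mul b₀).add (hf.const_sub 1)
    simpa using this
  have hdu : ∀ᶠ n in l, IsUnit (d n) :=
    hd.eventually (Units.isOpen.mem_nhds (show (1 : A) ∈ {x | IsUnit x} from isUnit_one))
  let c : α → A := fun n => Ring.inverse (d n) * b₀
  have hc : Tendsto c l (𝓝 b₀) := by
    simpa using (tendsto_ringInverse_of_isUnit isUnit_one hd).mul_const b₀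
  have hca : ∀ᶠ n in l, c n * a n = b n * a n := by
    filter_upwards [hdu] with n hn
    obtain ⟨e1, e2, -, -⟩ := h n
    have : d n * (b n * a n) = b₀ * a n := by
      simp only [d, add_mul, sub_mul, one_mul]
      rw [mul_assoc b₀, ← mul_assoc (a n), e1, ← mul_assoc (b n * a n), e2, sub_self, add_zero]
    simp only [c]
    rw [mul_assoc, ← this, ← mul_assoc, Ring.inverse_mul_cancel _ hn, one_mul]
  have hz : Tendsto (fun n => a n * c n + star (a n * c n) - 1) l
      (𝓝 (a₀ * b₀ + star (a₀ * b₀) - 1)) :=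
    ((ha.mul hc).add (ha.mul hc).star).sub_const 1
  have hidem : a₀ * b₀ * (a₀ * b₀) = a₀ * b₀ := by rw [← mul_assoc, h1]
  have hzu₀ := isUnit_add_star_sub_one hidem
  have hzu : ∀ᶠ n in l, IsUnit (a n * c n + star (a n * c n) - 1) :=
    hz.eventually (Units.isOpen.mem_nhds (show _ ∈ {x | IsUnit x} from hzu₀))
  -- The last factor is the range projection of the idempotent `a_n c_n`, eventually equal to `a_n
  -- b_n`; the whole product is then `b_n`.
  have hlim := (hf.mul hc).mul ((ha.mul hc).mul (tendsto_ringInverse_of_isUnit hzu₀ hz))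
  have hval : b₀ * a₀ * b₀ * (a₀ * b₀ * Ring.inverse (a₀ * b₀ + star (a₀ * b₀) - 1)) = b₀ := by
    have e1 : a₀ * b₀ * (a₀ * b₀ + star (a₀ * b₀) - 1) = a₀ * b₀ := by
      rw [h4, mul_sub, mul_add, hidem, mul_one, add_sub_cancel_right]
    have e2 : a₀ * b₀ * Ring.inverse (a₀ * b₀ + star (a₀ * b₀) - 1) = a₀ * b₀ := mul_ringInverse_eq hzu₀ e1
    rw [e2, h2, ← mul_assoc, h2]
  rw [hval] at hlim
  refine hlim.congr' ?_
  filter_upwards [hca, hzu] with n hn hu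
  obtain ⟨e1, e2, e3, e4⟩ := h n
  have g1 : a n * c n * (a n * b n) = a n * b n := by
    rw [mul_assoc, ← mul_assoc (c n), hn, e2]
  have g2 : a n * b n * (a n * c n) = a n * c n := by
    rw [← mul_assoc, e1]
  have g3 : a n * b n * star (a n * c n) = a n * b n := by
    have := congrArg star g1
    rwa [star_mul, e4] at this
  have g4 : a n * b n * (a n * c n + star (a n * c n) - 1) = a n * c n := by
    rw [mul_sub, mul_add, g2, g3, mul_one, add_sub_cancel_right]
  have g5 : a n * c n * Ring.inverse (a n * c n + star (a n * c n) - 1) = a n * b n := mul_ringInverse_eq hu g4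
  rw [g5, mul_assoc (b n * a n), ← mul_assoc (c n), hn, e2, e2]

theorem star_isMoorePenroseInverse {a : A} (ha : a ∈ partialIsometries A) :
    IsMoorePenroseInverse a (star a) := by
  refine ⟨mul_star_mul_of_mem_partialIsometries ha, ?_, ha.2.2, ha.1.2⟩
  have := congrArg star (mul_star_mul_of_mem_partialIsometries ha)
  simpa only [star_mul, star_star, mul_assoc] using this

end MoorePenrose

/-! ### Unitary polar parts near the unit -/

section Polar

variable {A : Type u} [CStarAlgebra A]

theorem contDiffAt_star {x : A} : ContDiffAt ℝ ω (star : A → A) x :=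
  (starL' ℝ : A ≃L[ℝ] A).contDiff.contDiffAt

theorem ContDiffAt.cstar {E : Type*} [NormedAddCommGroup E] [NormedSpace ℝ E] {f : E → A} {x : E}
    {n : WithTop ℕ∞} (hf : ContDiffAt ℝ n f x) : ContDiffAt ℝ n (fun y => star (f y)) x :=
  (contDiffAt_star.of_le le_top).comp x hf

theorem ContDiffAt.ringInverse_of_eq_one {E : Type*} [NormedAddCommGroup E] [NormedSpace ℝ E]
    {f : E → A} {x : E} (hf : ContDiffAt ℝ ω f x) (hx : f x = 1) :
    ContDiffAt ℝ ω (fun y => Ring.inverse (f y)) x := by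
  refine ContDiffAt.comp (g := Ring.inverse) x ?_ hf
  rw [hx]
  exact contDiffAt_ringInverse ℝ (1 : Aˣ)

theorem ContinuousAt.eventually_isUnit {E : Type*} [TopologicalSpace E] {f : E → A} {x : E}
    (hf : ContinuousAt f x) (hx : f x = 1) : ∀ᶠ y in 𝓝 x, IsUnit (f y) :=
  hf.eventually (Units.isOpen.mem_nhds (show f x ∈ {x | IsUnit x} from hx ▸ isUnit_one))

/-- The inverse function theorem gives both an analytic root and its uniqueness near `1`. Uniqueness
later yields self-adjointness and commutation of roots without functional calculus. -/
theorem exists_local_sqrt : ∃ s : A → A, ContDiffAt ℝ ω s 1 ∧ s 1 = 1 ∧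
    (∀ᶠ g in 𝓝 1, s g * s g = g) ∧ ∀ᶠ t in 𝓝 1, s (t * t) = t := by
  -- The factor `1/2` makes the derivative at `1` the identity.
  let f : A → A := fun t => (2⁻¹ : ℝ) • (t * t)
  have hf : ContDiffAt ℝ ω f 1 := (contDiffAt_id.mul contDiffAt_id).const_smul _
  have hfd : HasFDerivAt f ((ContinuousLinearEquiv.refl ℝ A : A ≃L[ℝ] A) : A →L[ℝ] A) 1 := by
    have h := ((hasFDerivAt_id (𝕜 := ℝ) (1 : A)).mul' (hasFDerivAt_id 1)).const_smul (2⁻¹ : ℝ)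
    refine h.congr_fderiv ?_
    ext v
    simp only [id_eq, one_smul, MulOpposite.op_one, smul_add, add_apply,
      smul_apply, ContinuousLinearMap.id_apply, ContinuousLinearEquiv.coe_refl]
    rw [← add_smul]
    norm_num
  have hs := hf.hasStrictFDerivAt' hfd (by simp)
  have hl : Tendsto (fun g : A => (2⁻¹ : ℝ) • g) (𝓝 1) (𝓝 (f 1)) := by
    have : Continuous fun g : A => (2⁻¹ : ℝ) • g := by fun_prop
    simpa [f] using this.tendsto 1
  refine ⟨fun g => hf.localInverse hfd (by simp) ((2⁻¹ : ℝ) • g), ?_, ?_, ?_, ?_⟩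
  · refine ContDiffAt.comp (g := hf.localInverse hfd (by simp)) 1 ?_ (contDiffAt_id.const_smul _)
    have h := hf.to_localInverse hfd (by simp)
    simpa [f] using h
  · have h := hf.localInverse_apply_image hfd (by simp)
    simpa [f] using h
  · filter_upwards [hl.eventually hs.eventually_right_inverse] with g hg
    exact smul_right_injective A (show (2⁻¹ : ℝ) ≠ 0 by norm_num) hg
  · exact hs.eventually_left_inverse

/-- The map is `W c = c (c^* c)^{-1/2}`. If `c p = e c` with `p`, `e` self-adjoint, then `p`
commutes with `c^* c`, hence with its root. The neighbourhood of `1` is uniform in `e`, as needed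
when `e` varies together with `c`. -/
theorem exists_polar : ∃ W : A → A, ContDiffAt ℝ ω W 1 ∧ W 1 = 1 ∧
    (∀ᶠ c in 𝓝 1, star (W c) * W c = 1 ∧ W c * star (W c) = 1) ∧
    (∀ c, star c * c = 1 → W c = c) ∧
    ∀ p : A, p * p = p → star p = p →
      ∀ᶠ c in 𝓝 1, ∀ e, star e = e → c * p = e * c → W c * p = e * W c := by
  obtain ⟨s, hs, hs1, hss, hst⟩ := exists_local_sqrt (A := A)
  let g : A → A := fun c => star c * c
  have hg1 : g 1 = 1 := by simp [g]
  have hg : ContDiffAt ℝ ω g 1 := contDiffAt_star.mul contDiffAt_id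
  have hgl : Tendsto g (𝓝 1) (𝓝 1) := by simpa [hg1] using hg.continuousAt.tendsto
  have hsg : ContDiffAt ℝ ω (fun c => s (g c)) 1 :=
    ContDiffAt.comp (g := s) 1 (by rwa [hg1]) hg
  have hsg1 : s (g 1) = 1 := by rw [hg1, hs1]
  have hsl : Tendsto (fun c => s (g c)) (𝓝 1) (𝓝 1) := by
    have := hsg.continuousAt.tendsto
    rwa [hsg1] at this
  have hsu := hsg.continuousAt.eventually_isUnit hsg1
  refine ⟨fun c => c * Ring.inverse (s (g c)), contDiffAt_id.mul (hsg.ringInverse_of_eq_one hsg1),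
    ?_, ?_, ?_, ?_⟩
  · simp [hsg1]
  · have hstar : Tendsto (fun c => star (s (g c))) (𝓝 1) (𝓝 1) := by simpa using hsl.star
    filter_upwards [hsu, hgl.eventually hss, hstar.eventually hst,
      continuousAt_id.eventually_isUnit (x := (1 : A)) rfl] with c h1 h2 h3 h4
    -- The adjoint of the root is another root of `c^* c` near `1`.
    have h5 : star (s (g c)) = s (g c) := by
      have : star (s (g c)) * star (s (g c)) = g c := by
        rw [← star_mul, h2]
        simp [g]
      rw [← h3, this]
    set t := Ring.inverse (s (g c))
    have ht : star t = t := by simp only [t]; rw [← Ring.inverse_star, h5]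
    have e1 : star (c * t) * (c * t) = 1 := by
      calc star (c * t) * (c * t) = t * g c * t := by
            rw [star_mul, ht]
            simp only [g, mul_assoc]
        _ = t * s (g c) * (s (g c) * t) := by
            conv_lhs => rw [← h2]
            simp only [mul_assoc]
        _ = 1 := by
            simp only [t]
            rw [Ring.inverse_mul_cancel _ h1, Ring.mul_inverse_cancel _ h1, one_mul]
    -- An invertible isometry is unitary, which supplies the second identity.
    have e2 : IsUnit (c * t) := h4.mul h1.ringInverse
    obtain ⟨u, hu⟩ := e2
    have e3 : star (c * t) = ↑u⁻¹ := Units.eq_inv_of_mul_eq_one_right (by rw [hu, e1])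
    exact ⟨e1, by rw [e3, ← hu, u.mul_inv]⟩
  · intro c hc
    simp [g, hc, hs1]
  · intro p hp hps
    -- Conjugation by the symmetry `σ` fixes `c^* c` and so, by local uniqueness, its root;
    -- commuting with `σ` means commuting with `p`.
    let σ : A := 2 • p - 1
    have hσ : σ * σ = 1 := by
      simp only [σ, sub_mul, mul_sub, two_smul, mul_add, add_mul, hp, mul_one, one_mul]
      abel
    have hl : Tendsto (fun c => σ * s (g c) * σ) (𝓝 1) (𝓝 1) := by
      have := (hsl.const_mul σ).mul_const σ
      simpa [hσ] using this
    filter_upwards [hsu, hgl.eventually hss, hl.eventually hst] with c h1 h2 h3 e he hce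
    have h4 : p * star c = star c * e := by
      have := congrArg star hce
      simpa only [star_mul, hps, he] using this
    have h5 : p * g c = g c * p := by
      simp only [g]
      rw [← mul_assoc, h4, mul_assoc, mul_assoc, hce]
    have h6 : σ * g c * σ = g c := by
      have : σ * g c = g c * σ := by simp only [σ, sub_mul, mul_sub, two_smul, add_mul, mul_add, h5,
        one_mul, mul_one]
      rw [this, mul_assoc, hσ, mul_one]
    have h7 : σ * s (g c) * σ = s (g c) := by
      have : σ * s (g c) * σ * (σ * s (g c) * σ) = g c := by
        calc σ * s (g c) * σ * (σ * s (g c) * σ) = σ * s (g c) * (σ * σ) * s (g c) * σ := by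
              simp only [mul_assoc]
          _ = σ * (s (g c) * s (g c)) * σ := by rw [hσ]; simp only [mul_assoc, one_mul]
          _ = g c := by rw [h2, h6]
      rw [← h3, this]
    have h8 : σ * s (g c) = s (g c) * σ := by
      calc σ * s (g c) = σ * s (g c) * (σ * σ) := by rw [hσ, mul_one]
        _ = s (g c) * σ := by rw [← mul_assoc, h7]
    have h9 : p * s (g c) = s (g c) * p := by
      have : (2 : ℝ) • (p * s (g c)) = (2 : ℝ) • (s (g c) * p) := by
        rw [two_smul, two_smul]
        simpa [σ, sub_mul, mul_sub, two_smul, add_mul, mul_add] using h8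
      exact smul_right_injective A (two_ne_zero (α := ℝ)) this
    set t := Ring.inverse (s (g c))
    have h10 : t * p = p * t := by
      calc t * p = t * (p * s (g c)) * t := by
            simp only [t]
            rw [mul_assoc, mul_assoc, Ring.mul_inverse_cancel _ h1, mul_one]
        _ = p * t := by
            simp only [t]
            rw [h9, ← mul_assoc, Ring.inverse_mul_cancel _ h1, one_mul]
    rw [mul_assoc, h10, ← mul_assoc, hce, mul_assoc]

/-- Projections close to `p` are conjugate to `p` by a unitary depending analytically on them. -/
theorem exists_unitary_intertwiner {p : A} (hp : p ∈ orthogonalProjections A) :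
    ∃ V : A → A, ContDiffAt ℝ ω V p ∧ V p = 1 ∧
      ∀ᶠ e in 𝓝 p, star (V e) * V e = 1 ∧ V e * star (V e) = 1 ∧
        (e ∈ orthogonalProjections A → V e * p = e * V e) := by
  obtain ⟨W, hW, hW1, hWu, -, hWi⟩ := exists_polar (A := A)
  obtain ⟨hpp, hps⟩ := hp
  -- For idempotent `e` both `d e * p` and `e * d e` equal `e p`, and `d p = 1`.
  let d : A → A := fun e => e * p + (1 - e) * (1 - p)
  have hd : ContDiffAt ℝ ω d p := (contDiffAt_id.mul contDiffAt_const).add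
    ((contDiffAt_const.sub contDiffAt_id).mul contDiffAt_const)
  have hd1 : d p = 1 := by
    simp only [d, sub_mul, mul_sub, one_mul, mul_one, hpp]
    abel
  have hdl : Tendsto d (𝓝 p) (𝓝 1) := by
    have := hd.continuousAt.tendsto
    rwa [hd1] at this
  refine ⟨fun e => W (d e), ContDiffAt.comp (g := W) p (by rwa [hd1]) hd,
    show W (d p) = 1 by rw [hd1, hW1], ?_⟩
  filter_upwards [hdl.eventually hWu, hdl.eventually (hWi p hpp hps)] with e h1 h2
  refine ⟨h1.1, h1.2, fun he => h2 e he.2 ?_⟩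
  have he1 : e * e = e := he.1
  simp only [d, add_mul, mul_add, sub_mul, mul_sub, one_mul, mul_one, ← mul_assoc, he1]
  simp only [mul_assoc, hpp]
  abel

end Polar

/-! ### Local retractions and local sections in `C^*`-algebras -/

section Retracts

variable {A : Type u} [CStarAlgebra A]

theorem eventually_isUnit_intertwiner {p : A} (hp : p * p = p) :
    ContDiffAt ℝ ω (fun e : A => e * p + (1 - e) * (1 - p)) p ∧
      p * p + (1 - p) * (1 - p) = 1 ∧ ∀ᶠ e in 𝓝 p, IsUnit (e * p + (1 - e) * (1 - p)) := by
  have hd : ContDiffAt ℝ ω (fun e : A => e * p + (1 - e) * (1 - p)) p :=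
    (contDiffAt_id.mul contDiffAt_const).add
      ((contDiffAt_const.sub contDiffAt_id).mul contDiffAt_const)
  have h1 : p * p + (1 - p) * (1 - p) = 1 := by
    simp only [sub_mul, mul_sub, one_mul, mul_one, hp]
    abel
  exact ⟨hd, h1, hd.continuousAt.eventually_isUnit h1⟩

theorem intertwiner_mul {p e : A} (hp : p * p = p) (he : e * e = e) :
    e * (e * p + (1 - e) * (1 - p)) = (e * p + (1 - e) * (1 - p)) * p := by
  simp only [add_mul, mul_add, sub_mul, mul_sub, one_mul, mul_one, ← mul_assoc, he]
  simp only [mul_assoc, hp]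
  abel

/-- The retraction is `e ↦ d p d⁻¹`: a conjugate of `p` for every nearby `e`, and `e` itself when
`e` is idempotent. -/
theorem isLocalRetract_idempotents : IsLocalRetract (idempotents A) := by
  intro p hp
  obtain ⟨hd, hd1, hdu⟩ := eventually_isUnit_intertwiner (p := p) hp
  refine ⟨fun e => (e * p + (1 - e) * (1 - p)) * p *
    Ring.inverse (e * p + (1 - e) * (1 - p)),
    (hd.mul contDiffAt_const).mul (hd.ringInverse_of_eq_one hd1), ?_⟩
  filter_upwards [hdu] with e he
  set d := e * p + (1 - e) * (1 - p) with hdef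
  refine ⟨?_, fun hee => mul_ringInverse_eq he (intertwiner_mul hp hee)⟩
  change d * p * Ring.inverse d * (d * p * Ring.inverse d) = _
  calc d * p * Ring.inverse d * (d * p * Ring.inverse d)
      = d * p * (Ring.inverse d * d) * p * Ring.inverse d := by simp only [mul_assoc]
    _ = d * (p * p) * Ring.inverse d := by
      rw [Ring.inverse_mul_cancel _ he]; simp only [mul_assoc, one_mul]
    _ = d * p * Ring.inverse d := by rw [show p * p = p from hp]

theorem isLocalRetract_inversePairs : IsLocalRetract (inversePairs A) := by
  rintro ⟨a, b⟩ ⟨hab, hba⟩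
  dsimp only at hab hba
  -- Here `d` intertwines the sources and `c` the targets. They are matched: on an inverse pair `(x,
  -- y)`, `c a = x d` and `d b = y c`, so `(c a d⁻¹, d b c⁻¹)` returns `(x, y)`.
  let c : A × A → A := fun z => z.1 * b + (1 - z.1 * z.2) * (1 - a * b)
  let d : A × A → A := fun z => z.2 * z.1 * (b * a) + (1 - z.2 * z.1) * (1 - b * a)
  have hc : ContDiffAt ℝ ω c (a, b) :=
    (contDiffAt_fst.mul contDiffAt_const).add
      ((contDiffAt_const.sub (contDiffAt_fst.mul contDiffAt_snd)).mul contDiffAt_const)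
  have hd : ContDiffAt ℝ ω d (a, b) :=
    ((contDiffAt_snd.mul contDiffAt_fst).mul contDiffAt_const).add
      ((contDiffAt_const.sub (contDiffAt_snd.mul contDiffAt_fst)).mul contDiffAt_const)
  have hc1 : c (a, b) = 1 := by
    simp only [c, mul_sub, sub_mul, one_mul, mul_one, ← mul_assoc, hab]
    abel
  have hd1 : d (a, b) = 1 := by
    simp only [d, mul_sub, sub_mul, one_mul, mul_one, ← mul_assoc, hba]
    abel
  refine ⟨fun z => (c z * a * Ring.inverse (d z), d z * b * Ring.inverse (c z)),
    ((hc.mul contDiffAt_const).mul (hd.ringInverse_of_eq_one hd1)).prodMk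
      ((hd.mul contDiffAt_const).mul (hc.ringInverse_of_eq_one hc1)), ?_⟩
  filter_upwards [hc.continuousAt.eventually_isUnit hc1,
    hd.continuousAt.eventually_isUnit hd1] with z hcz hdz
  refine ⟨⟨?_, ?_⟩, fun hz => Prod.ext ?_ ?_⟩
  · dsimp only
    generalize c z = c at *
    generalize d z = d at *
    calc c * a * Ring.inverse d * (d * b * Ring.inverse c) * (c * a * Ring.inverse d)
        = c * a * (Ring.inverse d * d) * b * (Ring.inverse c * c) * a * Ring.inverse d := by
          simp only [mul_assoc]
      _ = c * (a * b * a) * Ring.inverse d := by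
          rw [Ring.inverse_mul_cancel _ hcz, Ring.inverse_mul_cancel _ hdz]
          simp only [mul_assoc, one_mul]
      _ = c * a * Ring.inverse d := by rw [hab]
  · dsimp only
    generalize c z = c at *
    generalize d z = d at *
    calc d * b * Ring.inverse c * (c * a * Ring.inverse d) * (d * b * Ring.inverse c)
        = d * b * (Ring.inverse c * c) * a * (Ring.inverse d * d) * b * Ring.inverse c := by
          simp only [mul_assoc]
      _ = d * (b * a * b) * Ring.inverse c := by
          rw [Ring.inverse_mul_cancel _ hcz, Ring.inverse_mul_cancel _ hdz]
          simp only [mul_assoc, one_mul]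
      _ = d * b * Ring.inverse c := by rw [hba]
  · refine mul_ringInverse_eq hdz ?_
    obtain ⟨x, y⟩ := z
    have hx : x * y * x = x := hz.1
    have e1 : x * d (x, y) = x * (b * a) := by
      simp only [d, mul_add, mul_sub, sub_mul, one_mul, mul_one, ← mul_assoc, hx]
      abel
    have e2 : c (x, y) * a = x * (b * a) := by
      simp only [c, add_mul, mul_sub, sub_mul, one_mul, mul_one]
      simp only [mul_assoc, show a * (b * a) = a by rw [← mul_assoc, hab]]
      abel
    exact e1.trans e2.symm
  · refine mul_ringInverse_eq hcz ?_
    obtain ⟨x, y⟩ := z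
    have hy : y * x * y = y := hz.2
    have e1 : y * c (x, y) = y * x * b := by
      simp only [c, mul_add, mul_sub, sub_mul, one_mul, mul_one, ← mul_assoc, hy]
      abel
    have e2 : d (x, y) * b = y * x * b := by
      simp only [d, add_mul, mul_sub, sub_mul, one_mul, mul_one]
      simp only [mul_assoc, show b * (a * b) = b by rw [← mul_assoc, hba]]
      abel
    exact e1.trans e2.symm

theorem unitary_conj_mem_orthogonalProjections {p u : A} (hp : p ∈ orthogonalProjections A)
    (hu : star u * u = 1) : u * p * star u ∈ orthogonalProjections A := by
  constructor
  · calc u * p * star u * (u * p * star u) = u * p * (star u * u) * p * star u := by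
          simp only [mul_assoc]
      _ = u * (p * p) * star u := by rw [hu]; simp only [mul_assoc, one_mul]
      _ = u * p * star u := by rw [hp.1]
  · simp only [star_mul, star_star, hp.2, mul_assoc]

theorem unitary_mul_mul_mem_partialIsometries {a u v : A} (ha : a ∈ partialIsometries A)
    (hu : star u * u = 1) (hv : star v * v = 1) :
    u * a * star v ∈ partialIsometries A := by
  have h1 : u * a * star v * star (u * a * star v) = u * (a * star a) * star u := by
    calc u * a * star v * star (u * a * star v) = u * a * (star v * v) * star a * star u := by
          simp only [star_mul, star_star, mul_assoc]
      _ = u * (a * star a) * star u := by rw [hv]; simp only [mul_assoc, one_mul]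
  have h2 : star (u * a * star v) * (u * a * star v) = v * (star a * a) * star v := by
    calc star (u * a * star v) * (u * a * star v) = v * star a * (star u * u) * a * star v := by
          simp only [star_mul, star_star, mul_assoc]
      _ = v * (star a * a) * star v := by rw [hu]; simp only [mul_assoc, one_mul]
  constructor
  · rw [h1]
    exact unitary_conj_mem_orthogonalProjections ha.1 hu
  · rw [h2]
    exact unitary_conj_mem_orthogonalProjections ha.2 hv

theorem isLocalRetract_orthogonalProjections : IsLocalRetract (orthogonalProjections A) := by
  intro p hp
  obtain ⟨V, hV, -, h⟩ := exists_unitary_intertwiner hp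
  refine ⟨fun e => V e * p * star (V e), (hV.mul contDiffAt_const).mul hV.cstar, ?_⟩
  filter_upwards [h] with e ⟨h1, h2, h3⟩
  refine ⟨unitary_conj_mem_orthogonalProjections hp h1, fun he => ?_⟩
  rw [h3 he, mul_assoc, h2, mul_one]

/-- After moving the initial and final projections of `x` to those of `a`, the element `c^* x d a^*`
is an isometry of the corner at `a a^*`; adding `1 - a a^*` makes it one of the whole algebra. -/
theorem partialIsometry_transport {a x c d : A} (ha : a ∈ partialIsometries A)
    (hx : x ∈ partialIsometries A) (hc1 : c * star c = 1) (hd1 : d * star d = 1)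
    (hd2 : star d * d = 1) (hc : c * (a * star a) = x * star x * c)
    (hd : d * (star a * a) = star x * x * d) :
    star (star c * x * d * star a + (1 - a * star a)) *
        (star c * x * d * star a + (1 - a * star a)) = 1 ∧
      c * (star c * x * d * star a + (1 - a * star a)) * a * star d = x := by
  have haa := mul_star_mul_of_mem_partialIsometries ha
  have hxx := mul_star_mul_of_mem_partialIsometries hx
  have hcs : a * star a * star c = star c * (x * star x) := by
    have := congrArg star hc
    simpa only [star_mul, star_star, mul_assoc] using this
  set y := star c * x * d * star a
  have hpy : a * star a * y = y := by
    simp only [y, ← mul_assoc]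
    rw [hcs]
    simp only [mul_assoc]
    simp only [← mul_assoc x, ← mul_assoc (x * star x), hxx]
  have hyp : star y * (a * star a) = star y := by
    have := congrArg star hpy
    simpa only [star_mul, star_star] using this
  have hyy : star y * y = a * star a := by
    calc star y * y = a * star d * star x * (c * star c) * x * d * star a := by
          simp only [y, star_mul, star_star, mul_assoc]
      _ = a * star d * (star x * x * d) * star a := by
          rw [hc1]
          simp only [mul_assoc, one_mul]
      _ = a * (star d * d) * star a * a * star a := by
          rw [← hd]
          simp only [mul_assoc]
      _ = a * star a := by rw [hd2, mul_one, haa]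
  have hpp : a * star a * (a * star a) = a * star a := ha.1.1
  constructor
  · have hs : star (1 - a * star a) = 1 - a * star a := by simp
    rw [star_add, hs, add_mul, mul_add, mul_add, hyy]
    simp only [mul_sub, sub_mul, mul_one, one_mul, hpy, hyp, hpp]
    abel
  · have h1 : (y + (1 - a * star a)) * a = y * a := by
      simp only [add_mul, sub_mul, one_mul, haa, sub_self, add_zero]
    calc c * (y + (1 - a * star a)) * a * star d = c * star c * x * (d * (star a * a)) * star d := by
          rw [mul_assoc c, h1]
          simp only [y, mul_assoc]
      _ = x * star x * x * (d * star d) := by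
          rw [hc1, hd]
          simp only [mul_assoc, one_mul]
      _ = x := by rw [hd1, mul_one, hxx]

theorem isLocalRetract_partialIsometries : IsLocalRetract (partialIsometries A) := by
  intro a ha
  obtain ⟨W, hW, -, hWu, hWe, -⟩ := exists_polar (A := A)
  obtain ⟨V, hV, hV1, hVe⟩ := exists_unitary_intertwiner ha.1
  obtain ⟨U, hU, hU1, hUe⟩ := exists_unitary_intertwiner ha.2
  have hst : ContDiffAt ℝ ω (star : A → A) a := contDiffAt_star
  have hl : ContDiffAt ℝ ω (fun x : A => x * star x) a := contDiffAt_id.mul hst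
  have hr : ContDiffAt ℝ ω (fun x : A => star x * x) a := hst.mul contDiffAt_id
  let c : A → A := fun x => V (x * star x)
  let d : A → A := fun x => U (star x * x)
  have hc : ContDiffAt ℝ ω c a := ContDiffAt.comp (g := V) a hV hl
  have hd : ContDiffAt ℝ ω d a := ContDiffAt.comp (g := U) a hU hr
  -- For a partial isometry `x` this is an isometry, fixed by `W`, and `x = c w a d^*`. Replacing
  -- `w` by `W w` makes the formula produce a partial isometry for every nearby `x`.
  let w : A → A := fun x => star (c x) * x * d x * star a + (1 - a * star a)
  have hw : ContDiffAt ℝ ω w a :=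
    (((hc.cstar.mul contDiffAt_id).mul hd).mul contDiffAt_const).add contDiffAt_const
  have hw1 : w a = 1 := by simp [w, c, d, hV1, hU1]
  have hwl : Tendsto w (𝓝 a) (𝓝 1) := by
    have := hw.continuousAt.tendsto
    rwa [hw1] at this
  refine ⟨fun x => c x * W (w x) * a * star (d x),
    ((hc.mul (ContDiffAt.comp (g := W) a (by rwa [hw1]) hw)).mul contDiffAt_const).mul hd.cstar, ?_⟩
  filter_upwards [hl.continuousAt.eventually hVe, hr.continuousAt.eventually hUe,
    hwl.eventually hWu] with x ⟨hc1, hc2, hc3⟩ ⟨hd1, hd2, hd3⟩ ⟨hw2, _⟩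
  constructor
  · refine unitary_mul_mul_mem_partialIsometries ha ?_ hd1
    calc star (c x * W (w x)) * (c x * W (w x))
        = star (W (w x)) * (star (c x) * c x) * W (w x) := by simp only [star_mul, mul_assoc]
      _ = 1 := by rw [show star (c x) * c x = 1 from hc1, mul_one, hw2]
  · intro hx
    obtain ⟨h1, h2⟩ := partialIsometry_transport (c := c x) (d := d x) ha hx hc2 hd2 hd1
      (hc3 hx.1) (hd3 hx.2)
    rw [hWe (w x) h1]
    exact h2

/-- The section is `f ↦ (a d⁻¹, d b)`, with `d` intertwining `b a` and `f`. The source moves to `f`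
while the target `a b` stays fixed. -/
theorem hasLocalSections_src_inversePairs :
    HasLocalSections (inversePairsGroupoid A).src := by
  rintro ⟨⟨a, b⟩, hab, hba⟩
  dsimp only at hab hba
  have hq : b * a * (b * a) = b * a := by rw [← mul_assoc, hba]
  obtain ⟨hd, hd1, hdu⟩ := eventually_isUnit_intertwiner hq
  refine ⟨fun f => (a * Ring.inverse (f * (b * a) + (1 - f) * (1 - b * a)),
    (f * (b * a) + (1 - f) * (1 - b * a)) * b),
    (contDiffAt_const.mul (hd.ringInverse_of_eq_one hd1)).prodMk (hd.mul contDiffAt_const), ?_, ?_⟩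
  · change (a * Ring.inverse (b * a * (b * a) + (1 - b * a) * (1 - b * a)),
      (b * a * (b * a) + (1 - b * a) * (1 - b * a)) * b) = (a, b)
    rw [hd1, Ring.inverse_one, mul_one, one_mul]
  · change ∀ᶠ f in 𝓝 (b * a), _
    filter_upwards [hdu] with f hf hff
    have h1 := intertwiner_mul hq hff
    set d := f * (b * a) + (1 - f) * (1 - b * a)
    have h2 : d * b * (a * Ring.inverse d) = f := by
      rw [← mul_assoc, mul_assoc d]
      exact mul_ringInverse_eq hf h1
    have h3 : a * Ring.inverse d * (d * b) = a * b := by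
      rw [mul_assoc, ← mul_assoc _ d, Ring.inverse_mul_cancel _ hf, one_mul]
    refine ⟨⟨?_, ?_⟩, h2⟩
    · dsimp only
      rw [h3, ← mul_assoc, hab]
    · dsimp only
      rw [mul_assoc, h3, mul_assoc, ← mul_assoc b, hba]

theorem hasLocalSections_src_partialIsometries :
    HasLocalSections (partialIsometriesGroupoid A).src := by
  rintro ⟨a, ha⟩
  obtain ⟨V, hV, hV1, h⟩ := exists_unitary_intertwiner ha.2
  refine ⟨fun f => a * star (V f), contDiffAt_const.mul hV.cstar, ?_, ?_⟩
  · change a * star (V (star a * a)) = a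
    rw [hV1, star_one, mul_one]
  · change ∀ᶠ f in 𝓝 (star a * a), _
    filter_upwards [h] with f ⟨h1, h2, h3⟩ hf
    refine ⟨by simpa using unitary_mul_mul_mem_partialIsometries (u := 1) ha (by simp) h1, ?_⟩
    change star (a * star (V f)) * (a * star (V f)) = f
    calc star (a * star (V f)) * (a * star (V f)) = V f * (star a * a) * star (V f) := by
          simp only [star_mul, star_star, mul_assoc]
      _ = f := by rw [h3 hf, mul_assoc, h2, mul_one]

end Retracts

/-! ### Banach-Lie groupoids of local retracts -/

/-- Ambient formulas give continuity and smoothness of the structure maps, local sections make the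
source a submersion, and the target inherits its properties from `tgt = src ∘ inv`. -/
theorem IsLocalRetract.isBanachLie {E : Type u} [NormedAddCommGroup E] [NormedSpace ℝ E]
    [CompleteSpace E] {S : Set E} {E' : Type u} [NormedAddCommGroup E'] [NormedSpace ℝ E']
    [CompleteSpace E'] {B : Set E'} (hS : IsLocalRetract S) (hB : IsLocalRetract B)
    (Γ : GroupoidOver S B) {s : E → E'} {i : E → E} {m : E × E → E} {o : E' → E}
    (hs : ContDiff ℝ ω s) (hi : ContDiff ℝ ω i) (hm : ContDiff ℝ ω m) (ho : Continuous o)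
    (hsrc : ∀ x, (Γ.src x : E') = s x) (hinv : ∀ x, (Γ.inv x : E) = i x)
    (hmul : ∀ x y w, (Γ.mul x y w : E) = m (x, y)) (hone : ∀ p, (Γ.one p : E) = o p)
    (hii : Function.Involutive Γ.inv) (hsec : HasLocalSections Γ.src) :
    Γ.IsBanachLie hS.manifold hB.manifold := by
  have csrc : Continuous Γ.src := by
    rw [Topology.IsInducing.subtypeVal.continuous_iff]
    exact (hs.continuous.comp continuous_subtype_val).congr fun x => (hsrc x).symm
  have cinv : Continuous Γ.inv := by
    rw [Topology.IsInducing.subtypeVal.continuous_iff]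
    exact (hi.continuous.comp continuous_subtype_val).congr fun x => (hinv x).symm
  have cone : Continuous Γ.one := by
    rw [Topology.IsInducing.subtypeVal.continuous_iff]
    exact (ho.comp continuous_subtype_val).congr fun x => (hone x).symm
  have cmul : Continuous Γ.mulMap := by
    rw [Topology.IsInducing.subtypeVal.continuous_iff]
    refine Continuous.congr (f := fun z : Γ.composable => m (z.1.1, z.1.2)) ?_
      fun z => (hmul _ _ z.2).symm
    exact hm.continuous.comp (by fun_prop)
  have hinvh : IsHomeomorph Γ.inv :=
    isHomeomorph_iff_exists_inverse.2 ⟨cinv, Γ.inv, hii, hii, cinv⟩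
  have htgt : Γ.tgt = Γ.src ∘ Γ.inv := funext fun x => (Γ.src_inv x).symm
  have hsurj : Function.Surjective Γ.src := fun p => ⟨Γ.one p, Γ.src_one p⟩
  refine ⟨⟨⟨inferInstance, hsurj, hsec.isOpenMap, csrc, fun p => ⟨Γ.one p, Γ.tgt_one p⟩, ?_, ?_,
    cmul, Function.LeftInverse.isEmbedding Γ.src_one csrc cone, hinvh⟩, ?_, ?_, ?_⟩,
    inferInstance⟩
  · rw [htgt]
    exact hsec.isOpenMap.comp hinvh.isOpenMap
  · rw [htgt]
    exact csrc.comp cinv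
  · exact hS.isSubmersion hB (hs.of_le le_top) hsrc hsurj hsec
  · exact hS.smooth_of_extension hS (hi.of_le le_top) hinv
  · exact hS.smoothOnSubset hS hm fun z => hmul _ _ z.2

/-! ### The groupoids of partial isometries and of inverse pairs. -/

section

variable {A : Type u} [CStarAlgebra A]

theorem contDiff_star : ContDiff ℝ ω (star : A → A) :=
  contDiff_iff_contDiffAt.2 fun _ => contDiffAt_star

theorem isBanachLie_partialIsometriesGroupoid :
    (partialIsometriesGroupoid A).IsBanachLie isLocalRetract_partialIsometries.manifold
      isLocalRetract_orthogonalProjections.manifold :=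
  isLocalRetract_partialIsometries.isBanachLie isLocalRetract_orthogonalProjections
    (partialIsometriesGroupoid A) (s := fun a => star a * a) (i := star)
    (m := fun z => z.1 * z.2) (o := id) (contDiff_star.mul contDiff_id) contDiff_star
    (contDiff_fst.mul contDiff_snd) continuous_id (fun _ => rfl) (fun _ => rfl)
    (fun _ _ _ => rfl) (fun _ => rfl) (fun a => Subtype.ext (star_star a.1))
    hasLocalSections_src_partialIsometries

theorem isBanachLie_inversePairsGroupoid :
    (inversePairsGroupoid A).IsBanachLie isLocalRetract_inversePairs.manifold
      isLocalRetract_idempotents.manifold :=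
  isLocalRetract_inversePairs.isBanachLie isLocalRetract_idempotents
    (inversePairsGroupoid A) (s := fun x => x.2 * x.1) (i := Prod.swap)
    (m := fun z => (z.1.1 * z.2.1, z.2.2 * z.1.2)) (o := fun p => (p, p))
    (contDiff_snd.mul contDiff_fst) (contDiff_snd.prodMk contDiff_fst)
    (((contDiff_fst.comp contDiff_fst).mul (contDiff_fst.comp contDiff_snd)).prodMk
      ((contDiff_snd.comp contDiff_snd).mul (contDiff_snd.comp contDiff_fst)))
    (by fun_prop) (fun _ => rfl) (fun _ => rfl)
    (fun _ _ _ => rfl) (fun _ => rfl) (fun _ => rfl)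
    hasLocalSections_src_inversePairs

theorem isClosed_idempotents : IsClosed (idempotents A) :=
  isClosed_eq (by fun_prop) continuous_id

theorem isClosed_inversePairs : IsClosed (inversePairs A) :=
  (isClosed_eq (by fun_prop) continuous_fst).inter (isClosed_eq (by fun_prop) continuous_snd)

theorem isClosed_orthogonalProjections : IsClosed (orthogonalProjections A) :=
  isClosed_idempotents.inter (isClosed_eq continuous_star continuous_id)

theorem isClosed_partialIsometries : IsClosed (partialIsometries A) :=
  (isClosed_orthogonalProjections.preimage (continuous_id.mul continuous_star)).inter
    (isClosed_orthogonalProjections.preimage (continuous_star.mul continuous_id))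

theorem partialIsometries_subset_regularElements :
    partialIsometries A ⊆ regularElements A := fun a ha =>
  ⟨star a, (mul_star_mul_of_mem_partialIsometries ha).symm⟩

end

theorem proposition7p8 {A : Type u} [CStarAlgebra A] :
    -- every regular element has a unique Moore-Penrose inverse, denoted by `moorePenroseInverse`
    (∀ a ∈ regularElements A, (∃! b : A, IsMoorePenroseInverse a b) ∧
      IsMoorePenroseInverse a (moorePenroseInverse a)) ∧
    -- (i) the maps `η` and `π` are well defined
    ∃ (η : regularElements A → inversePairs A) (π : inversePairs A → regularElements A),
      (∀ a : regularElements A, (η a : A × A) = ((a : A), moorePenroseInverse (a : A))) ∧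
      (∀ x : inversePairs A, (π x : A) = (x : A × A).1) ∧
      π ∘ η = id ∧
      -- (ii)
      (∀ (a : ℕ → regularElements A) (a₀ : regularElements A),
        (∀ n, (a n : A) ≠ 0) → (a₀ : A) ≠ 0 → Tendsto a atTop (𝓝 a₀) →
        (Tendsto (fun n => η (a n)) atTop (𝓝 (η a₀)) ↔
          Tendsto (fun n => (inversePairsGroupoid A).src (η (a n))) atTop
            (𝓝 ((inversePairsGroupoid A).src (η a₀))))) ∧
      -- (iii)
      ∃ (hU : partialIsometries A ⊆ regularElements A)
        (XU : BanachManifold (partialIsometries A)) (XP : BanachManifold (orthogonalProjections A))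
        (XG : BanachManifold (inversePairs A)) (XQ : BanachManifold (idempotents A)),
        XU.IsSubmanifold ∧ XP.IsSubmanifold ∧ XG.IsSubmanifold ∧ XQ.IsSubmanifold ∧
        Function.Injective (η ∘ Set.inclusion hU) ∧
        (partialIsometriesGroupoid A).IsBanachLieHom XU XP (inversePairsGroupoid A) XG XQ
          (η ∘ Set.inclusion hU)
          (Set.inclusion (orthogonalProjections_subset_idempotents A)) := by
  refine ⟨fun a ha => ⟨⟨_, isMoorePenroseInverse_moorePenroseInverse ha, fun b hb =>
    hb.unique (isMoorePenroseInverse_moorePenroseInverse ha)⟩,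
    isMoorePenroseInverse_moorePenroseInverse ha⟩, ?_⟩
  let η : regularElements A → inversePairs A := fun a => ⟨(a, moorePenroseInverse (a : A)),
    (isMoorePenroseInverse_moorePenroseInverse a.2).1,
    (isMoorePenroseInverse_moorePenroseInverse a.2).2.1⟩
  let π : inversePairs A → regularElements A := fun x => ⟨x.1.1, x.1.2, x.2.1.symm⟩
  have hsrc : Continuous (inversePairsGroupoid A).src :=
    isBanachLie_inversePairsGroupoid.isTopological.src_continuous
  refine ⟨η, π, fun _ => rfl, fun _ => rfl, rfl, ?_, partialIsometries_subset_regularElements,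
    isLocalRetract_partialIsometries.manifold, isLocalRetract_orthogonalProjections.manifold,
    isLocalRetract_inversePairs.manifold, isLocalRetract_idempotents.manifold,
    isLocalRetract_partialIsometries.isSubmanifold isClosed_partialIsometries,
    isLocalRetract_orthogonalProjections.isSubmanifold isClosed_orthogonalProjections,
    isLocalRetract_inversePairs.isSubmanifold isClosed_inversePairs,
    isLocalRetract_idempotents.isSubmanifold isClosed_idempotents, ?_, ?_⟩
  · intro a a₀ _ _ ha
    refine ⟨fun h => (hsrc.tendsto _).comp h, fun h => ?_⟩
    rw [tendsto_subtype_rng] at ha h ⊢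
    exact ha.prodMk_nhds (tendsto_moorePenroseInverse
      (fun n => isMoorePenroseInverse_moorePenroseInverse (a n).2)
      (isMoorePenroseInverse_moorePenroseInverse a₀.2) ha h)
  · intro a b h
    exact Subtype.ext (congrArg (fun x : inversePairs A => x.1.1) h)
  -- On partial isometries `η` is `a ↦ (a, a^*)`; compatibility with the groupoid operations and
  -- smoothness all follow from this formula.
  · have hη : ∀ a : partialIsometries A,
        (η (Set.inclusion partialIsometries_subset_regularElements a) : A × A) =
          ((a : A), star (a : A)) := fun a =>
      Prod.ext rfl (star_isMoorePenroseInverse a.2).eq_moorePenroseInverse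
    have hη2 : ∀ a : partialIsometries A, moorePenroseInverse (a : A) = star (a : A) := fun a =>
      (star_isMoorePenroseInverse a.2).eq_moorePenroseInverse
    refine ⟨isBanachLie_partialIsometriesGroupoid, isBanachLie_inversePairsGroupoid,
      ⟨fun a => ?_, fun a => ?_, fun a => ?_, fun a b w => ?_, fun p => ?_⟩, ?_, ?_, ?_⟩
    · exact Subtype.ext (congrArg (· * (a : A)) (hη2 a))
    · exact Subtype.ext (congrArg ((a : A) * ·) (hη2 a))
    · refine Subtype.ext ((hη _).trans (Prod.ext ?_ ?_))
      · exact (hη2 a).symm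
      · exact star_star _
    · refine Subtype.ext ((hη _).trans (Prod.ext rfl ?_))
      change star ((a : A) * b) = moorePenroseInverse (b : A) * moorePenroseInverse (a : A)
      rw [star_mul, hη2, hη2]
    · exact Subtype.ext ((hη _).trans (Prod.ext rfl p.2.2))
    · rw [Topology.IsInducing.subtypeVal.continuous_iff]
      refine Continuous.congr (f := fun a : partialIsometries A => ((a : A), star (a : A))) ?_
        fun a => (hη a).symm
      fun_prop
    · exact continuous_inclusion _
    · exact isLocalRetract_partialIsometries.smooth_of_extension isLocalRetract_inversePairs
        (g := fun a => (a, star a)) (contDiff_id.prodMk (contDiff_star.of_le le_top)) hη
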